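/- Let $n \ge 0$ be an integer and let $\Phi:\mathbb{C}^n\to\mathbb{R}$ be a strictly convex real-valued quadratic form (quadratic in $(\operatorname{Re}x,\operatorname{Im}x)$). Let $H_\Phi(\mathbb{C}^n;1)$ be the space of entire functions $u$ with $\|u\|_{H_\Phi}^2=\int_{\mathbb{C}^n}|u(x)|^2e^{-2\Phi(x)}\,dL(x)<\infty$, where $dL$ is Lebesgue measure on $\mathbb{C}^n\cong\mathbb{R}^{2n}$. Put $\partial_{x_j}=\frac12(\partial_{\operatorname{Re}x_j}-i\partial_{\operatorname{Im}x_j})$, $\partial_{\bar x_j}=\frac12(\partial_{\operatorname{Re}x_j}+i\partial_{\operatorname{Im}x_j})$, $\Phi''_{xx}=(\partial_{x_j}\partial_{x_k}\Phi)_{j,k}$ and $\Phi''_{\bar xx}=(\partial_{\bar x_j}\partial_{x_k}\Phi)_{j,k}$. Say that a pair of complex $n\times n$ matrices $(G,C)$ represents $\Phi$ if $G$ is invertible, $C$ is symmetric, and $$\Phi''_{\bar xx}=\tfrac14G^*G,\qquad \Phi''_{xx}=-\tfrac14G^tCG .$$ Then the pair $G=2(\Phi''_{\bar xx})^{1/2}$,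 $C_+=-4G^{-t}\Phi''_{xx}G^{-1}$ represents $\Phi$. Moreover there exist a strictly convex real-valued quadratic form $\Phi^\dagger$ on $\mathbb{C}^n$ and a real constant $C_\Phi$ such that: 1. For every pair $(G,C_+)$ representing $\Phi$, the matrix $1-C_+^*C_+$ is positive definite; with $E=(1-C_+^*C_+)^{-1/2}$ the pair $G^\dagger=E(G^*)^{-1}$, $C_+^\dagger=-E^{-t}C_+E$ represents $\Phi^\dagger$; and $$C_\Phi=(2\pi)^{-n}\det(1-C_+^*C_+)^{-1/4}.$$ 2. For every multi-index $\alpha\in\mathbb{N}_0^n$, the monomial $x^\alpha$ belongs to $H_\Phi(\mathbb{C}^n;1)$ and to $H_{\Phi^\dagger}(\mathbb{C}^n;1)$, the map $$\Pi_\alpha u(x)=(\alpha!)^{-1}(\partial^\alpha u(0))\,x^\alpha$$ is a bounded linear operator on $H_\Phi(\mathbb{C}^n;1)$, and its operator norm is $$\|\Pi_\alpha\|_{\mathcal{L}(H_\Phi(\mathbb{C}^n;1))}=\frac{C_\Phi}{\alpha!\,2^{|\alpha|}}\,\|x^\alpha\|_{H_\Phi(\mathbb{C}^n;1)}\,\|x^\alpha\|_{H_{\Phi^\dagger}(\mathbb{C}^n;1)}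 .$$ -/

import Mathlib

open MeasureTheory
open scoped Matrix ENNReal MatrixOrder ComplexOrder Nat

noncomputable section

namespace QuadWeight

/-- The holomorphic derivative `∂_{x_j} = (∂_{Re x_j} - i ∂_{Im x_j}) / 2` on functions on `ℂⁿ`. -/
def dHol {n : ℕ} (j : Fin n) (f : (Fin n → ℂ) → ℂ) (x : Fin n → ℂ) : ℂ :=
  (1 / 2) * (fderiv ℝ f x (Pi.single j 1) - Complex.I * fderiv ℝ f x (Pi.single j Complex.I))

/-- The antiholomorphic derivative `∂_{x̄_j} = (∂_{Re x_j} + i ∂_{Im x_j}) / 2`. -/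
def dAnti {n : ℕ} (j : Fin n) (f : (Fin n → ℂ) → ℂ) (x : Fin n → ℂ) : ℂ :=
  (1 / 2) * (fderiv ℝ f x (Pi.single j 1) + Complex.I * fderiv ℝ f x (Pi.single j Complex.I))

/-- The iterated holomorphic derivative `∂^α = ∂_{x_1}^{α_1} ⋯ ∂_{x_n}^{α_n}`. -/
def dHolMulti {n : ℕ} (α : Fin n → ℕ) (f : (Fin n → ℂ) → ℂ) : (Fin n → ℂ) → ℂ :=
  (List.finRange n).foldr (fun j g => (dHol j)^[α j] g) f

/-- The multi-index factorial `α!`. -/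
def multiFactorial {n : ℕ} (α : Fin n → ℕ) : ℕ := ∏ j, (α j)!

/-- The monomial `x^α`. -/
def monom {n : ℕ} (α : Fin n → ℕ) (x : Fin n → ℂ) : ℂ := ∏ j, x j ^ α j

/-- The matrix `Φ''_{xx}`, with entries `∂_{x_j} ∂_{x_k} Φ` (constant, as `Φ` is quadratic). -/
def hessHol {n : ℕ} (Φ : QuadraticForm ℝ (Fin n → ℂ)) : Matrix (Fin n) (Fin n) ℂ :=
  Matrix.of fun j k => dHol j (dHol k fun x => (Φ x : ℂ)) 0

/-- The matrix `Φ''_{x̄x}`, with entries `∂_{x̄_j} ∂_{x_k} Φ` (constant, as `Φ` is quadratic). -/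
def hessMixed {n : ℕ} (Φ : QuadraticForm ℝ (Fin n → ℂ)) : Matrix (Fin n) (Fin n) ℂ :=
  Matrix.of fun j k => dAnti j (dHol k fun x => (Φ x : ℂ)) 0

/-- `Φ` is the weight with reduction data `(G, C)`: `G` is invertible, `C` is symmetric,
`Φ''_{x̄x} = G^* G / 4` and `Φ''_{xx} = - G^t C G / 4`. -/
structure IsReduction {n : ℕ} (Φ : QuadraticForm ℝ (Fin n → ℂ))
    (G C : Matrix (Fin n) (Fin n) ℂ) : Prop where
  isUnit_det : IsUnit G.det
  isSymm : C.IsSymm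
  hessMixed_eq : hessMixed Φ = (1 / 4 : ℂ) • (Gᴴ * G)
  hessHol_eq : hessHol Φ = -((1 / 4 : ℂ) • (Gᵀ * C * G))

/-- The standard choice `G = 2 (Φ''_{x̄x})^{1/2}`. -/
def stdG {n : ℕ} (Φ : QuadraticForm ℝ (Fin n → ℂ)) : Matrix (Fin n) (Fin n) ℂ :=
  (2 : ℂ) • CFC.sqrt (hessMixed Φ)

/-- The matrix `C_+ = -4 G^{-t} Φ''_{xx} G^{-1}` for the standard choice of `G`. -/
def stdC {n : ℕ} (Φ : QuadraticForm ℝ (Fin n → ℂ)) : Matrix (Fin n) (Fin n) ℂ :=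
  -((4 : ℂ) • (((stdG Φ)⁻¹)ᵀ * hessHol Φ * (stdG Φ)⁻¹))

/-- The positive definite matrix `E = (1 - C^* C)^{-1/2}`. -/
def dualE {n : ℕ} (C : Matrix (Fin n) (Fin n) ℂ) : Matrix (Fin n) (Fin n) ℂ :=
  CFC.sqrt ((1 - Cᴴ * C)⁻¹)

/-- `G^† = E (G^*)^{-1}`. -/
def dualG {n : ℕ} (G C : Matrix (Fin n) (Fin n) ℂ) : Matrix (Fin n) (Fin n) ℂ :=
  dualE C * (Gᴴ)⁻¹

/-- `C^† = - E^{-t} C E`. -/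
def dualC {n : ℕ} (C : Matrix (Fin n) (Fin n) ℂ) : Matrix (Fin n) (Fin n) ℂ :=
  -(((dualE C)⁻¹)ᵀ * C * dualE C)

/-- The measure `e^{-2Φ(x)} dL(x)` on `ℂⁿ`. -/
def weightMeasure {n : ℕ} (Φ : QuadraticForm ℝ (Fin n → ℂ)) : Measure (Fin n → ℂ) :=
  volume.withDensity fun x => ENNReal.ofReal (Real.exp (-2 * Φ x))

/-- `Hol(ℂⁿ) ∩ L²(ℂⁿ; e^{-2Φ} dL)` as a space of functions. -/
def holL2 {n : ℕ} (Φ : QuadraticForm ℝ (Fin n → ℂ)) : Submodule ℂ ((Fin n → ℂ) → ℂ) where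
  carrier := {u | Differentiable ℂ u ∧ MemLp u 2 (weightMeasure Φ)}
  add_mem' := fun hu hv => ⟨hu.1.add hv.1, hu.2.add hv.2⟩
  zero_mem' := ⟨differentiable_const 0, MemLp.zero⟩
  smul_mem' := fun c _ hu => ⟨hu.1.const_smul c, hu.2.const_smul c⟩

/-- The space `H_Φ(ℂⁿ; 1)`. It is a type of its own, so that it carries the `L²` norm and
not the topology of pointwise convergence. -/
def HSpace {n : ℕ} (Φ : QuadraticForm ℝ (Fin n → ℂ)) : Type := holL2 Φ

namespace HSpace

variable {n : ℕ} (Φ : QuadraticForm ℝ (Fin n → ℂ))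

instance : AddCommGroup (HSpace Φ) := inferInstanceAs (AddCommGroup (holL2 Φ))

instance : Module ℂ (HSpace Φ) := inferInstanceAs (Module ℂ (holL2 Φ))

instance : CoeFun (HSpace Φ) fun _ => (Fin n → ℂ) → ℂ := ⟨fun u => u.1⟩

/-- The inclusion of `H_Φ` in the Hilbert space `L²(ℂⁿ; e^{-2Φ} dL)`. -/
def toL2 : HSpace Φ →ₗ[ℂ] Lp ℂ 2 (weightMeasure Φ) where
  toFun u := u.2.2.toLp u.1
  map_add' _ _ := rfl
  map_smul' _ _ := rfl

theorem continuous_weight : Continuous Φ := by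
  have h : ∀ x, Φ x = QuadraticMap.associated (R := ℝ) Φ x x := fun x =>
    (QuadraticMap.associated_eq_self_apply ℝ Φ x).symm
  have h2 : Continuous fun x : Fin n → ℂ => QuadraticMap.associated (R := ℝ) Φ x x := by
    let B := QuadraticMap.associated (R := ℝ) Φ
    let L : (Fin n → ℂ) →ₗ[ℝ] ((Fin n → ℂ) →L[ℝ] ℝ) :=
      (LinearMap.toContinuousLinearMap (𝕜 := ℝ) (E := Fin n → ℂ) (F' := ℝ)).toLinearMap ∘ₗ B
    have hL : Continuous L := L.continuous_of_finiteDimensional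
    exact hL.clm_apply continuous_id
  exact h2.congr fun x => (h x).symm

theorem toL2_injective : Function.Injective (toL2 Φ) := by
  intro u v h
  have h1 : u.1 =ᵐ[weightMeasure Φ] v.1 := (MemLp.toLp_eq_toLp_iff u.2.2 v.2.2).1 h
  have hm : Measurable fun x => ENNReal.ofReal (Real.exp (-2 * Φ x)) := by
    have := (continuous_weight Φ).measurable
    fun_prop
  have hac : (volume : Measure (Fin n → ℂ)) ≪ weightMeasure Φ :=
    withDensity_absolutelyContinuous' hm.aemeasurable
      (Filter.Eventually.of_forall fun x => by simp [Real.exp_pos])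
  exact Subtype.ext ((u.2.1.continuous.ae_eq_iff_eq volume v.2.1.continuous).1 (hac.ae_eq h1))

/-- `H_Φ` carries the norm of `L²(ℂⁿ; e^{-2Φ} dL)`. -/
instance : NormedAddCommGroup (HSpace Φ) :=
  NormedAddCommGroup.induced (HSpace Φ) (Lp ℂ 2 (weightMeasure Φ)) (toL2 Φ) (toL2_injective Φ)

instance : NormedSpace ℂ (HSpace Φ) :=
  NormedSpace.induced ℂ (HSpace Φ) (Lp ℂ 2 (weightMeasure Φ)) (toL2 Φ)

end HSpace

end QuadWeight

end

/-!
The weight is a positive definite real quadratic form, and the operator `Π_α` has rank one: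
`Π_α u = (α!)⁻¹ ∂^α u(0) x^α`. Its norm is therefore `(α!)⁻¹ ‖x^α‖_Φ` times the norm of the functional
`u ↦ ∂^α u(0)`, and the proof computes the element `k_α` of `H_Φ` representing this functional.

Let `A` be the gradient map of `Φ`, the real-linear map with `dΦ(x) v = Re ((A x)^* v)`. The dual
weight is `Φ†(z) = Φ(A⁻¹ z) / 4`, the Legendre transform of `Φ` for the pairing `Re (z^* x) / 2`; in
this form it does not involve a reduction `(G, C)`. Inverting
`A x = 2 (Φ''_{x̄x} x + star (Φ''_{xx} x))` shows that every reduction of `Φ` produces a reduction of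
this one `Φ†` (`isReduction_dual`).

The analytic core is the Gaussian form of the duality (`integral_dualWeight`): the integral
`∫ e^{(z^* x + y^* z)/2 - 2Φ†(z)} dL(z)` is a constant multiple of the reproducing kernel
`e^{2Ψ(x, ȳ)}` of `H_Φ`, where `Ψ` is the polarisation of `Φ`. The reproducing property of
`e^{2Ψ(x, ȳ)}` is the mean value property of entire functions (`integral_mul_exp_polarWeight`). The
two facts together write every `u` in `H_Φ` as a Laplace transform
`u(x) = C_Φ² ∫ e^{z^* x / 2} g(z) dL(z)` (`laplace_density`). Differentiating under the integral gives
`∂^α u(0) = ⟨k_α, u⟩`, where `k_α` is `C_Φ² 2^{-|α|}` times the Laplace transform of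
`z^α e^{-2Φ†(z)}` (`dHolMulti_eq_inner`). Differentiating `k_α` itself in the same way gives
`‖k_α‖² = ∂^α k_α(0) = C_Φ² 4^{-|α|} ‖x^α‖²_{Φ†}`, which is the norm formula (`norm_derivKernel`).
The double integrals over `y` and `z` converge by the Fenchel inequality between `Φ` and `Φ†`
(`fenchel`).

The constant is a ratio of Gaussian integrals, hence of real determinants of gradient maps. With the
antilinear `K w = star (C w)` the gradient map is `A = G^* (1 - K) G / 2`, and the identities
`det_ℝ (1 - K) = det_ℝ (1 + K)` and `(1 - K) (1 + K) = 1 - C^* C` yield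
`|det_ℝ (1 - K)| = det (1 - C^* C)` (`abs_det_one_sub_conjMul`).
-/

namespace QuadWeight

/-! ### Real quadratic forms and their complex Hessians -/

section Forms

/-- The symmetric real bilinear form whose diagonal is `Φ`. -/
noncomputable def bilin {n : ℕ} (Φ : QuadraticForm ℝ (Fin n → ℂ)) :
    (Fin n → ℂ) →ₗ[ℝ] (Fin n → ℂ) →ₗ[ℝ] ℝ :=
  QuadraticMap.associated (R := ℝ) Φ

variable {n : ℕ} (Φ : QuadraticForm ℝ (Fin n → ℂ))

theorem bilin_self (x : Fin n → ℂ) : bilin Φ x x = Φ x :=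
  QuadraticMap.associated_eq_self_apply ℝ Φ x

theorem bilin_comm (x y : Fin n → ℂ) : bilin Φ x y = bilin Φ y x :=
  QuadraticMap.associated_isSymm ℝ Φ x y

theorem weight_add (x y : Fin n → ℂ) : Φ (x + y) = Φ x + 2 * bilin Φ x y + Φ y := by
  simp only [← bilin_self, map_add, LinearMap.add_apply]
  rw [bilin_comm Φ y x]; ring

theorem weight_sub (x y : Fin n → ℂ) : Φ (x - y) = Φ x - 2 * bilin Φ x y + Φ y := by
  simp only [← bilin_self, map_sub, LinearMap.sub_apply]
  rw [bilin_comm Φ y x]; ring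

theorem weight_real_smul (c : ℝ) (x : Fin n → ℂ) : Φ (c • x) = c ^ 2 * Φ x := by
  rw [QuadraticMap.map_smul, smul_eq_mul]; ring

/-- The derivative `∂_{x_k} Φ`, as a real-linear function of the point. -/
noncomputable def gradCoord (k : Fin n) : (Fin n → ℂ) →ₗ[ℝ] ℂ :=
  Complex.ofRealCLM.toLinearMap ∘ₗ (bilin Φ).flip (Pi.single k 1) -
    Complex.I • (Complex.ofRealCLM.toLinearMap ∘ₗ (bilin Φ).flip (Pi.single k Complex.I))

theorem gradCoord_apply (k : Fin n) (x : Fin n → ℂ) : gradCoord Φ k x =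
    (bilin Φ x (Pi.single k 1) : ℂ) - Complex.I * bilin Φ x (Pi.single k Complex.I) := by
  simp [gradCoord]

theorem fderiv_weight (x v : Fin n → ℂ) :
    fderiv ℝ (fun y => (Φ y : ℂ)) x v = 2 * (bilin Φ x v : ℂ) := by
  let L : (Fin n → ℂ) →L[ℝ] (Fin n → ℂ) →L[ℝ] ℝ :=
    LinearMap.toContinuousLinearMap
      ((LinearMap.toContinuousLinearMap (𝕜 := ℝ) (E := Fin n → ℂ) (F' := ℝ)).toLinearMap ∘ₗ
        bilin Φ)
  have hL : ∀ a b, L a b = bilin Φ a b := fun _ _ => rfl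
  have h1 : HasFDerivAt (fun y => L y y)
      ((L x).comp (ContinuousLinearMap.id ℝ _) + (L.flip x).comp (ContinuousLinearMap.id ℝ _)) x := by
    have := (L.hasFDerivAt (x := x)).clm_apply (hasFDerivAt_id (𝕜 := ℝ) x)
    refine this.congr_fderiv ?_
    ext v
    simp
  have h2 := Complex.ofRealCLM.hasFDerivAt.comp x h1
  have h3 : (fun y => (Φ y : ℂ)) = Complex.ofRealCLM ∘ fun y => L y y := by
    ext y
    simp [hL, bilin_self]
  rw [h3, h2.fderiv]
  simp only [ContinuousLinearMap.comp_id, ContinuousLinearMap.coe_comp, Function.comp_apply,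
    add_apply, ContinuousLinearMap.flip_apply, hL, bilin_comm Φ v x,
    Complex.ofRealCLM_apply]
  push_cast; ring

theorem dHol_weight (k : Fin n) : dHol k (fun x => (Φ x : ℂ)) = gradCoord Φ k := by
  ext x
  rw [dHol, fderiv_weight, fderiv_weight, gradCoord_apply]; ring

theorem fderiv_gradCoord (k : Fin n) (x v : Fin n → ℂ) :
    fderiv ℝ (gradCoord Φ k) x v = gradCoord Φ k v := by
  have := (LinearMap.toContinuousLinearMap (gradCoord Φ k)).fderiv (x := x)
  rw [LinearMap.coe_toContinuousLinearMap'] at this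
  rw [this]; rfl

theorem hessHol_apply (j k : Fin n) : hessHol Φ j k = (1 / 2) *
    (gradCoord Φ k (Pi.single j 1) - Complex.I * gradCoord Φ k (Pi.single j Complex.I)) := by
  rw [hessHol, Matrix.of_apply, dHol_weight, dHol, fderiv_gradCoord, fderiv_gradCoord]

theorem hessMixed_apply (j k : Fin n) : hessMixed Φ j k = (1 / 2) *
    (gradCoord Φ k (Pi.single j 1) + Complex.I * gradCoord Φ k (Pi.single j Complex.I)) := by
  rw [hessMixed, Matrix.of_apply, dHol_weight, dAnti, fderiv_gradCoord, fderiv_gradCoord]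

/-- A real-linear function on `ℂⁿ` is the sum of its values on the coordinate vectors `e_j` and
`i e_j`, weighted by the real and imaginary parts of the coordinates. -/
theorem map_eq_sum_re_im {M : Type*} [AddCommGroup M] [Module ℝ M] (L : (Fin n → ℂ) →ₗ[ℝ] M)
    (x : Fin n → ℂ) : L x = ∑ j, ((x j).re • L (Pi.single j 1) +
      (x j).im • L (Pi.single j Complex.I)) := by
  have hx : x = ∑ j, ((x j).re • (Pi.single j 1 : Fin n → ℂ) +
      (x j).im • (Pi.single j Complex.I : Fin n → ℂ)) := by
    conv_lhs => rw [← Finset.univ_sum_single x]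
    refine Finset.sum_congr rfl fun j _ => ?_
    rw [← Pi.single_smul', ← Pi.single_smul', ← Pi.single_add]
    congr 1
    simp [Complex.re_add_im]
  conv_lhs => rw [hx]
  simp [map_sum]

theorem gradCoord_eq (k : Fin n) (x : Fin n → ℂ) :
    gradCoord Φ k x = (star x ᵥ* hessMixed Φ) k + (x ᵥ* hessHol Φ) k := by
  rw [map_eq_sum_re_im (gradCoord Φ k) x]
  simp only [Matrix.vecMul, dotProduct, hessHol_apply, hessMixed_apply, Pi.star_apply,
    ← Finset.sum_add_distrib]
  refine Finset.sum_congr rfl fun j _ => ?_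
  have h1 : x j = (x j).re + (x j).im * Complex.I := (Complex.re_add_im _).symm
  have h2 : star (x j) = (x j).re - (x j).im * Complex.I := by
    apply Complex.ext <;> simp
  rw [h2]
  nth_rw 5 [h1]
  simp only [Complex.real_smul]
  linear_combination ((x j).im * gradCoord Φ k (Pi.single j Complex.I)) * Complex.I_sq

/-- A real quadratic form is determined by its two complex Hessians. -/
theorem bilin_eq (x v : Fin n → ℂ) : bilin Φ x v =
    (star x ⬝ᵥ hessMixed Φ *ᵥ v + x ⬝ᵥ hessHol Φ *ᵥ v).re := by
  rw [Matrix.dotProduct_mulVec, Matrix.dotProduct_mulVec, ← add_dotProduct]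
  rw [map_eq_sum_re_im (bilin Φ x) v, dotProduct, Complex.re_sum]
  refine Finset.sum_congr rfl fun k _ => ?_
  rw [Pi.add_apply, ← gradCoord_eq, gradCoord_apply]
  simp; ring

theorem weight_eq (x : Fin n → ℂ) : Φ x =
    (star x ⬝ᵥ hessMixed Φ *ᵥ x + x ⬝ᵥ hessHol Φ *ᵥ x).re := by
  rw [← bilin_self, bilin_eq]

theorem hess_unique {P Q : Matrix (Fin n) (Fin n) ℂ}
    (h : ∀ x v, bilin Φ x v = (star x ⬝ᵥ P *ᵥ v + x ⬝ᵥ Q *ᵥ v).re) :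
    hessMixed Φ = P ∧ hessHol Φ = Q := by
  constructor <;> ext j k
  all_goals
    simp only [hessMixed_apply, hessHol_apply, gradCoord_apply, h, Pi.star_single]
    apply Complex.ext <;> simp <;> ring

theorem hessHol_isSymm : (hessHol Φ).IsSymm := by
  ext j k
  simp only [Matrix.transpose_apply, hessHol_apply, gradCoord_apply]
  rw [bilin_comm Φ (Pi.single k 1) (Pi.single j 1), bilin_comm Φ (Pi.single k 1),
    bilin_comm Φ (Pi.single k Complex.I) (Pi.single j 1), bilin_comm Φ (Pi.single k Complex.I)]
  ring

theorem hessMixed_isHermitian : (hessMixed Φ).IsHermitian := by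
  ext j k
  simp only [Matrix.conjTranspose_apply, hessMixed_apply, gradCoord_apply]
  rw [bilin_comm Φ (Pi.single k 1) (Pi.single j 1), bilin_comm Φ (Pi.single k 1),
    bilin_comm Φ (Pi.single k Complex.I) (Pi.single j 1), bilin_comm Φ (Pi.single k Complex.I)]
  apply Complex.ext <;> simp
  ring

variable {Φ}

theorem posDef_of_strictConvexOn (hΦ : StrictConvexOn ℝ Set.univ (fun x => Φ x)) :
    Φ.PosDef := by
  intro x hx
  have h := hΦ.2 (Set.mem_univ x) (Set.mem_univ (-x))
    (fun h => hx (by simpa [self_eq_neg] using h))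
    (one_half_pos (α := ℝ)) (one_half_pos (α := ℝ)) (by norm_num)
  simp only [smul_neg, add_neg_cancel, QuadraticMap.map_zero, QuadraticMap.map_neg,
    smul_eq_mul] at h
  linarith

theorem strictConvexOn_of_posDef (hΦ : Φ.PosDef) : StrictConvexOn ℝ Set.univ fun x => Φ x := by
  refine ⟨convex_univ, fun x _ y _ hxy a b ha hb hab => ?_⟩
  have h := mul_pos (mul_pos ha hb) (hΦ (x - y) (sub_ne_zero.2 hxy))
  rw [weight_sub] at h
  simp only [weight_add, weight_real_smul, map_smul, LinearMap.smul_apply, smul_eq_mul]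
  obtain rfl : b = 1 - a := by linarith
  nlinarith

/-- Averaging `Φ` over `x` and `i x` leaves the Hermitian part, so `Φ''_{x̄x}` is positive. -/
theorem hessMixed_posDef (hΦ : Φ.PosDef) : (hessMixed Φ).PosDef := by
  refine Matrix.PosDef.of_dotProduct_mulVec_pos (hessMixed_isHermitian Φ) fun x hx => ?_
  have h1 := hΦ x hx
  have h2 := hΦ (Complex.I • x) (smul_ne_zero Complex.I_ne_zero hx)
  rw [weight_eq] at h1 h2
  simp only [star_smul, Matrix.mulVec_smul, smul_dotProduct, dotProduct_smul, smul_eq_mul,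
    Complex.star_def, Complex.conj_I, Complex.add_re, Complex.mul_re, Complex.mul_im, Complex.neg_re,
    Complex.neg_im, Complex.I_re, Complex.I_im] at h1 h2
  have him := (hessMixed_isHermitian Φ).im_star_dotProduct_mulVec_self x
  rw [Complex.pos_iff]
  refine ⟨by linarith, him.symm⟩

end Forms

/-! ### Square roots and symmetric contractions -/

section Matrices

variable {n : ℕ}

theorem star_mulVec_eq (M : Matrix (Fin n) (Fin n) ℂ) (v : Fin n → ℂ) :
    star (M *ᵥ v) = Mᴴᵀ *ᵥ star v := by
  rw [Matrix.star_mulVec, Matrix.mulVec_transpose]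

/-- The Sylvester equation `X Z + Z Y = 0` with positive definite `X` and `Y` has only the
solution zero. -/
theorem eq_zero_of_posDef_mul_add_mul_posDef {X Y Z : Matrix (Fin n) (Fin n) ℂ}
    (hX : X.PosDef) (hY : Y.PosDef) (h : X * Z + Z * Y = 0) : Z = 0 := by
  have h1 : (Zᴴ * X * Z).PosSemidef := hX.posSemidef.conjTranspose_mul_mul_same Z
  have h2 : (Z * Y * Zᴴ).PosSemidef := hY.posSemidef.mul_mul_conjTranspose_same Z
  have h3 : (Zᴴ * X * Z).trace + (Z * Y * Zᴴ).trace = 0 := by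
    rw [Matrix.trace_mul_comm (Z * Y), ← Matrix.trace_add, Matrix.mul_assoc, ← Matrix.mul_add, h,
      Matrix.mul_zero, Matrix.trace_zero]
  have h4 : (Zᴴ * X * Z).trace = 0 :=
    le_antisymm (by rw [eq_neg_of_add_eq_zero_left h3]; simpa using h2.trace_nonneg)
      h1.trace_nonneg
  rw [h1.trace_eq_zero_iff] at h4
  refine Matrix.ext_of_mulVec_single fun j => ?_
  rw [Matrix.zero_mulVec]
  by_contra hne
  have h5 := (Matrix.posDef_iff_dotProduct_mulVec.1 hX).2 hne
  rw [Matrix.star_mulVec, ← Matrix.dotProduct_mulVec, Matrix.mulVec_mulVec, Matrix.mulVec_mulVec,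
    h4] at h5
  simp at h5

theorem posDef_sqrt {M : Matrix (Fin n) (Fin n) ℂ} (hM : M.PosDef) : (CFC.sqrt M).PosDef := by
  have h0 : (CFC.sqrt M).PosSemidef := Matrix.nonneg_iff_posSemidef.1 (CFC.sqrt_nonneg M)
  refine (Matrix.PosSemidef.posDef_iff_isUnit h0).2 ?_
  exact (CFC.isUnit_sqrt_iff M hM.posSemidef.nonneg).2 hM.isUnit

theorem dualE_posDef {C : Matrix (Fin n) (Fin n) ℂ} (h : (1 - Cᴴ * C).PosDef) :
    (dualE C).PosDef :=
  posDef_sqrt h.inv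

theorem dualE_mul_self {C : Matrix (Fin n) (Fin n) ℂ} (h : (1 - Cᴴ * C).PosDef) :
    dualE C * dualE C = (1 - Cᴴ * C)⁻¹ :=
  CFC.sqrt_mul_sqrt_self _ h.inv.posSemidef.nonneg

/-- A symmetric `C` satisfies `Cᴴᵀ = Cᴴ`, hence intertwines `1 - Cᴴ C` with its transpose. -/
theorem one_sub_transpose_mul {C : Matrix (Fin n) (Fin n) ℂ} (hC : C.IsSymm) :
    (1 - Cᴴ * C)ᵀ * C = C * (1 - Cᴴ * C) := by
  have h1 : Cᴴᵀ = Cᴴ := by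
    ext i j
    simp [hC.apply i j]
  rw [Matrix.transpose_sub, Matrix.transpose_mul, h1, hC.eq, Matrix.transpose_one]
  noncomm_ring

/-- A symmetric `C` intertwines `E = (1 - Cᴴ C)^{-1/2}` with its transpose `(1 - C Cᴴ)^{-1/2}`. -/
theorem dualE_transpose_mul {C : Matrix (Fin n) (Fin n) ℂ} (hC : C.IsSymm)
    (h : (1 - Cᴴ * C).PosDef) : (dualE C)ᵀ * C = C * dualE C := by
  set N := 1 - Cᴴ * C with hN
  have hdet : IsUnit N.det := (Matrix.isUnit_iff_isUnit_det _).1 h.isUnit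
  have h1 : N⁻¹ᵀ * C = C * N⁻¹ := by
    have h2 : Nᵀ * C = C * N := one_sub_transpose_mul hC
    have hdet' : IsUnit Nᵀ.det := by rwa [Matrix.det_transpose]
    rw [Matrix.transpose_nonsing_inv]
    calc Nᵀ⁻¹ * C = Nᵀ⁻¹ * (C * N) * N⁻¹ := by
          rw [Matrix.mul_assoc, Matrix.mul_assoc, Matrix.mul_nonsing_inv _ hdet, Matrix.mul_one]
      _ = C * N⁻¹ := by
          rw [← h2, ← Matrix.mul_assoc, Matrix.nonsing_inv_mul _ hdet', Matrix.one_mul]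
  refine sub_eq_zero.1 (eq_zero_of_posDef_mul_add_mul_posDef (dualE_posDef h).transpose
    (dualE_posDef h) ?_)
  have h3 := dualE_mul_self h
  rw [← hN] at h3
  calc (dualE C)ᵀ * ((dualE C)ᵀ * C - C * dualE C) + ((dualE C)ᵀ * C - C * dualE C) * dualE C
      = (dualE C * dualE C)ᵀ * C - C * (dualE C * dualE C) := by
        rw [Matrix.transpose_mul]; noncomm_ring
    _ = 0 := by rw [h3, h1, sub_self]

theorem dualC_eq {C : Matrix (Fin n) (Fin n) ℂ} (hC : C.IsSymm) (h : (1 - Cᴴ * C).PosDef) :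
    dualC C = -C := by
  have hdet : IsUnit (dualE C).det := (Matrix.isUnit_iff_isUnit_det _).1 (dualE_posDef h).isUnit
  have hdet' : IsUnit (dualE C)ᵀ.det := by rwa [Matrix.det_transpose]
  rw [dualC, Matrix.mul_assoc, ← dualE_transpose_mul hC h, ← Matrix.mul_assoc,
    Matrix.transpose_nonsing_inv, Matrix.nonsing_inv_mul _ hdet', Matrix.one_mul]

end Matrices

/-! ### Reductions of a weight -/

section Reductions

variable {n : ℕ} {Φ : QuadraticForm ℝ (Fin n → ℂ)}

theorem isReduction_std (hΦ : Φ.PosDef) : IsReduction Φ (stdG Φ) (stdC Φ) := by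
  have hP := hessMixed_posDef hΦ
  have hs := posDef_sqrt hP
  have hdet : IsUnit (stdG Φ).det := by
    rw [stdG, Matrix.det_smul, isUnit_iff_ne_zero]
    exact mul_ne_zero (by simp) hs.det_pos.ne'
  have hdet' : IsUnit (stdG Φ)ᵀ.det := by rwa [Matrix.det_transpose]
  refine ⟨hdet, ?_, ?_, ?_⟩
  · rw [stdC, Matrix.IsSymm, Matrix.transpose_neg, Matrix.transpose_smul, Matrix.transpose_mul,
      Matrix.transpose_mul, (hessHol_isSymm Φ).eq, Matrix.transpose_transpose, Matrix.mul_assoc]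
  · have h1 : (stdG Φ)ᴴ = stdG Φ := by
      rw [stdG, Matrix.conjTranspose_smul, hs.isHermitian.eq]; simp
    rw [h1, stdG, Matrix.smul_mul, Matrix.mul_smul,
      CFC.sqrt_mul_sqrt_self _ hP.posSemidef.nonneg, smul_smul, smul_smul]
    norm_num
  · have h1 : (stdG Φ)ᵀ * (((stdG Φ)⁻¹)ᵀ * hessHol Φ * (stdG Φ)⁻¹) * stdG Φ = hessHol Φ := by
      rw [Matrix.transpose_nonsing_inv]
      calc _ = ((stdG Φ)ᵀ * (stdG Φ)ᵀ⁻¹) * hessHol Φ * ((stdG Φ)⁻¹ * stdG Φ) := by noncomm_ring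
        _ = _ := by rw [Matrix.mul_nonsing_inv _ hdet', Matrix.nonsing_inv_mul _ hdet,
                      Matrix.one_mul, Matrix.mul_one]
    rw [stdC, Matrix.mul_neg, Matrix.neg_mul, Matrix.mul_smul, Matrix.smul_mul, h1, smul_neg,
      neg_neg, smul_smul]
    norm_num

variable {G C : Matrix (Fin n) (Fin n) ℂ}

/-- In the coordinates `w = G x` the weight is `(|w|² - Re(wᵗ C w)) / 4`. -/
theorem IsReduction.weight_eq (h : IsReduction Φ G C) (x : Fin n → ℂ) :
    Φ x = (star (G *ᵥ x) ⬝ᵥ (G *ᵥ x) - (G *ᵥ x) ⬝ᵥ C *ᵥ (G *ᵥ x)).re / 4 := by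
  rw [QuadWeight.weight_eq, h.hessMixed_eq, h.hessHol_eq]
  have h1 : star x ⬝ᵥ ((1 / 4 : ℂ) • (Gᴴ * G)) *ᵥ x =
      (1 / 4 : ℂ) * (star (G *ᵥ x) ⬝ᵥ (G *ᵥ x)) := by
    rw [Matrix.smul_mulVec, dotProduct_smul, smul_eq_mul, Matrix.star_mulVec,
      ← Matrix.dotProduct_mulVec, Matrix.mulVec_mulVec]
  have h2 : x ⬝ᵥ (-((1 / 4 : ℂ) • (Gᵀ * C * G))) *ᵥ x =
      -((1 / 4 : ℂ) * ((G *ᵥ x) ⬝ᵥ C *ᵥ (G *ᵥ x))) := by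
    rw [Matrix.neg_mulVec, dotProduct_neg, Matrix.smul_mulVec, dotProduct_smul, smul_eq_mul,
      ← Matrix.mulVec_mulVec, ← Matrix.mulVec_mulVec, Matrix.dotProduct_mulVec x,
      Matrix.vecMul_transpose]
  rw [h1, h2]
  simp
  ring

/-- Polarisation turns `|Re(wᵗ C w)| < |w|²` into `|C w| < |w|`. -/
theorem IsReduction.posDef (hΦ : Φ.PosDef) (h : IsReduction Φ G C) : (1 - Cᴴ * C).PosDef := by
  have hpos : ∀ w : Fin n → ℂ, w ≠ 0 → (w ⬝ᵥ C *ᵥ w).re < (star w ⬝ᵥ w).re := by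
    intro w hw
    have hG : G *ᵥ (G⁻¹ *ᵥ w) = w := by
      rw [Matrix.mulVec_mulVec, Matrix.mul_nonsing_inv _ h.isUnit_det, Matrix.one_mulVec]
    have h1 := hΦ (G⁻¹ *ᵥ w) fun h0 => hw (by rw [← hG, h0, Matrix.mulVec_zero])
    rw [h.weight_eq, hG, Complex.sub_re] at h1
    linarith
  have hneg : ∀ w : Fin n → ℂ, w ≠ 0 → -(w ⬝ᵥ C *ᵥ w).re < (star w ⬝ᵥ w).re := by
    intro w hw
    have h1 := hpos (Complex.I • w) (smul_ne_zero Complex.I_ne_zero hw)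
    simp only [star_smul, Matrix.mulVec_smul, smul_dotProduct, dotProduct_smul, smul_eq_mul,
      ← mul_assoc, Complex.star_def, Complex.conj_I, neg_mul, mul_neg, Complex.I_mul_I, neg_neg,
      one_mul, Complex.neg_re] at h1
    exact h1
  refine Matrix.PosDef.of_dotProduct_mulVec_pos
    (Matrix.isHermitian_one.sub (Matrix.isHermitian_conjTranspose_mul_self C)) fun w hw => ?_
  have him := (Matrix.isHermitian_one.sub
    (Matrix.isHermitian_conjTranspose_mul_self C)).im_star_dotProduct_mulVec_self w
  rw [Complex.pos_iff]
  refine ⟨?_, him.symm⟩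
  -- Polarise at `a = star (C w)`, for which `aᵗ C w = |C w|² = |a|²`.
  set a := star (C *ᵥ w) with ha
  have hle : ∀ w : Fin n → ℂ, (w ⬝ᵥ C *ᵥ w).re ≤ (star w ⬝ᵥ w).re := fun w => by
    rcases eq_or_ne w 0 with rfl | hw
    · simp
    · exact (hpos w hw).le
  have hle' : ∀ w : Fin n → ℂ, -(w ⬝ᵥ C *ᵥ w).re ≤ (star w ⬝ᵥ w).re := fun w => by
    rcases eq_or_ne w 0 with rfl | hw
    · simp
    · exact (hneg w hw).le
  have hsum : ((a + w) ⬝ᵥ C *ᵥ (a + w)).re - ((a - w) ⬝ᵥ C *ᵥ (a - w)).re <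
      (star (a + w) ⬝ᵥ (a + w)).re + (star (a - w) ⬝ᵥ (a - w)).re := by
    by_cases h0 : a + w = 0
    · have h1 : a - w ≠ 0 := fun h1 => hw <| by
        have h2 : (2 : ℂ) • w = (a + w) - (a - w) := by rw [two_smul]; abel
        rw [h0, h1, sub_zero] at h2
        exact (smul_eq_zero.1 h2).resolve_left two_ne_zero
      linarith [hle (a + w), hneg _ h1]
    · linarith [hpos _ h0, hle' (a - w)]
  have hsymm : w ⬝ᵥ C *ᵥ a = a ⬝ᵥ C *ᵥ w := by
    rw [Matrix.dotProduct_mulVec, ← Matrix.mulVec_transpose, h.isSymm.eq, dotProduct_comm]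
  have hstar : star w ⬝ᵥ a = star (star a ⬝ᵥ w) := by
    rw [Matrix.star_dotProduct_star, star_star, dotProduct_comm]
  have haa : star a ⬝ᵥ a = a ⬝ᵥ C *ᵥ w := by
    rw [ha, star_star, dotProduct_comm]
  have hgoal : star w ⬝ᵥ (1 - Cᴴ * C) *ᵥ w = star w ⬝ᵥ w - a ⬝ᵥ C *ᵥ w := by
    rw [Matrix.sub_mulVec, Matrix.one_mulVec, dotProduct_sub, ← Matrix.mulVec_mulVec,
      Matrix.dotProduct_mulVec (star w), ← Matrix.star_mulVec]
  rw [hgoal, Complex.sub_re]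
  simp only [Matrix.mulVec_add, Matrix.mulVec_sub, star_add, star_sub, add_dotProduct,
    sub_dotProduct, dotProduct_add, dotProduct_sub, hsymm, haa, Complex.add_re,
    Complex.sub_re] at hsum
  linarith

end Reductions

/-! ### The dual weight -/

section Dual

variable {n : ℕ} (Φ : QuadraticForm ℝ (Fin n → ℂ))

/-- The gradient of `Φ` for the real inner product `Re (x^* v)`: the real-linear map `A` on `ℂⁿ`
for which `2 bilin Φ x v = Re ((A x)^* v)`. Its `k`-th component is twice the conjugate of
`∂_{x_k} Φ`. -/
noncomputable def gradMap : (Fin n → ℂ) →ₗ[ℝ] (Fin n → ℂ) :=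
  LinearMap.pi fun k => (2 : ℝ) • (Complex.conjAe.toLinearMap ∘ₗ gradCoord Φ k)

theorem gradMap_apply (x : Fin n → ℂ) :
    gradMap Φ x = (2 : ℂ) • (hessMixed Φ *ᵥ x + star (hessHol Φ *ᵥ x)) := by
  have h1 : hessMixed Φ *ᵥ x = star (star x ᵥ* hessMixed Φ) := by
    rw [Matrix.star_vecMul, star_star, (hessMixed_isHermitian Φ).eq]
  have h2 : hessHol Φ *ᵥ x = x ᵥ* hessHol Φ := by
    rw [← Matrix.mulVec_transpose, (hessHol_isSymm Φ).eq]
  rw [h1, h2]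
  ext k
  simp only [gradMap, LinearMap.pi_apply, LinearMap.smul_apply, LinearMap.comp_apply,
    gradCoord_eq, Pi.smul_apply, Pi.add_apply, Pi.star_apply]
  simp [mul_add]

theorem re_star_gradMap_dotProduct (x v : Fin n → ℂ) :
    (star (gradMap Φ x) ⬝ᵥ v).re = 2 * bilin Φ x v := by
  rw [bilin_eq, gradMap_apply, star_smul, star_add, star_star, Matrix.star_mulVec,
    (hessMixed_isHermitian Φ).eq, smul_dotProduct, add_dotProduct, ← Matrix.dotProduct_mulVec,
    Matrix.dotProduct_mulVec x, ← Matrix.mulVec_transpose, (hessHol_isSymm Φ).eq]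
  simp

theorem re_star_dotProduct_gradMap (x v : Fin n → ℂ) :
    (star v ⬝ᵥ gradMap Φ x).re = 2 * bilin Φ x v := by
  have h : star v ⬝ᵥ gradMap Φ x = star (star (gradMap Φ x) ⬝ᵥ v) :=
    Matrix.star_dotProduct _ _
  rw [h, ← re_star_gradMap_dotProduct]; simp

variable {Φ}

theorem gradMap_injective (hΦ : Φ.PosDef) : Function.Injective (gradMap Φ) := by
  refine (injective_iff_map_eq_zero _).2 fun x hx => ?_
  by_contra hne
  have h := re_star_gradMap_dotProduct Φ x x
  rw [hx, bilin_self] at h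
  have := hΦ x hne
  simp at h
  linarith

/-- The gradient map of a positive definite weight, as a linear equivalence. -/
noncomputable def gradEquiv (hΦ : Φ.PosDef) : (Fin n → ℂ) ≃ₗ[ℝ] (Fin n → ℂ) :=
  LinearEquiv.ofInjectiveEndo (gradMap Φ) (gradMap_injective hΦ)

@[simp] theorem gradEquiv_apply (hΦ : Φ.PosDef) (x : Fin n → ℂ) :
    gradEquiv hΦ x = gradMap Φ x := rfl

/-- The dual weight `Φ†(z) = Φ(A⁻¹ z) / 4`, where `A` is the gradient map. It is the Legendre
transform `sup_x (Re (z^* x) / 2 - Φ(x))`, the supremum being attained at `x = A⁻¹ z / 2`. -/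
noncomputable def dualWeight (hΦ : Φ.PosDef) : QuadraticForm ℝ (Fin n → ℂ) :=
  (1 / 4 : ℝ) • Φ.comp (gradEquiv hΦ).symm.toLinearMap

theorem dualWeight_apply (hΦ : Φ.PosDef) (z : Fin n → ℂ) :
    dualWeight hΦ z = Φ ((gradEquiv hΦ).symm z) / 4 := by
  simp [dualWeight]; ring

theorem dualWeight_posDef (hΦ : Φ.PosDef) : (dualWeight hΦ).PosDef := by
  intro z hz
  rw [dualWeight_apply]
  have := hΦ ((gradEquiv hΦ).symm z) (by simpa using hz)
  positivity

theorem dualWeight_two_smul_gradMap (hΦ : Φ.PosDef) (t : Fin n → ℂ) :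
    dualWeight hΦ ((2 : ℝ) • gradMap Φ t) = Φ t := by
  rw [dualWeight_apply, map_smul, ← gradEquiv_apply hΦ, LinearEquiv.symm_apply_apply,
    weight_real_smul]
  ring

/-- The Fenchel inequality for `Φ` and `Φ†`, applied to `√s y` and `z / √s`. The free factor `s`
leaves room for strict domination of both Gaussians. -/
theorem fenchel (hΦ : Φ.PosDef) {s : ℝ} (hs : 0 < s) (y z : Fin n → ℂ) :
    (star y ⬝ᵥ z).re / 2 ≤ s * Φ y + s⁻¹ * dualWeight hΦ z := by
  obtain ⟨t, rfl⟩ := (gradEquiv hΦ).surjective z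
  rw [dualWeight_apply, LinearEquiv.symm_apply_apply, gradEquiv_apply,
    re_star_dotProduct_gradMap, bilin_comm]
  have h := hΦ.nonneg ((2 * s) • y - t)
  rw [weight_sub, weight_real_smul, map_smul, LinearMap.smul_apply, smul_eq_mul] at h
  have h2 : s * Φ y + s⁻¹ * (Φ t / 4) - 2 * bilin Φ y t / 2 =
      ((2 * s) ^ 2 * Φ y - 2 * (2 * s * bilin Φ y t) + Φ t) / (4 * s) := by
    field_simp
    ring
  have h3 : 0 ≤ ((2 * s) ^ 2 * Φ y - 2 * (2 * s * bilin Φ y t) + Φ t) / (4 * s) := by positivity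
  linarith

theorem bilin_dualWeight (hΦ : Φ.PosDef) (z v : Fin n → ℂ) :
    bilin (dualWeight hΦ) z v = (star z ⬝ᵥ (gradEquiv hΦ).symm v).re / 8 := by
  have h1 : bilin (dualWeight hΦ) z v =
      bilin Φ ((gradEquiv hΦ).symm z) ((gradEquiv hΦ).symm v) / 4 := by
    have h := weight_add (dualWeight hΦ) z v
    rw [dualWeight_apply, dualWeight_apply, dualWeight_apply, map_add, weight_add] at h
    linarith
  have h2 := re_star_gradMap_dotProduct Φ ((gradEquiv hΦ).symm z) ((gradEquiv hΦ).symm v)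
  rw [← gradEquiv_apply hΦ, LinearEquiv.apply_symm_apply] at h2
  rw [h1, h2]
  ring

/-- The Hessians of the dual weight are read off from the inverse of the gradient map. -/
theorem hess_dualWeight (hΦ : Φ.PosDef) {P Q : Matrix (Fin n) (Fin n) ℂ}
    (h1 : hessMixed Φ * P + (hessHol Φ)ᴴᵀ * Q = (1 / 16 : ℂ) • 1)
    (h2 : hessHol Φ * P + (hessMixed Φ)ᴴᵀ * Q = 0) :
    hessMixed (dualWeight hΦ) = P ∧ hessHol (dualWeight hΦ) = Q := by
  refine hess_unique _ fun z v => ?_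
  have hinv : (gradEquiv hΦ).symm v = (8 : ℂ) • (P *ᵥ v + star (Q *ᵥ v)) := by
    rw [LinearEquiv.symm_apply_eq, gradEquiv_apply, gradMap_apply, Matrix.mulVec_smul,
      Matrix.mulVec_smul, Matrix.mulVec_add, Matrix.mulVec_add, star_smul, star_add]
    rw [star_mulVec_eq Q v, Matrix.mulVec_mulVec, Matrix.mulVec_mulVec, Matrix.mulVec_mulVec,
      Matrix.mulVec_mulVec, star_mulVec_eq _ (star v), star_star,
      Matrix.conjTranspose_mul, Matrix.transpose_mul, star_mulVec_eq (hessHol Φ * P)]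
    have h2' : (hessHol Φ * P)ᴴᵀ + hessMixed Φ * Qᴴᵀ = 0 := by
      have := congrArg (fun M : Matrix (Fin n) (Fin n) ℂ => Mᴴᵀ) h2
      have h3 : (hessMixed Φ)ᴴᵀᴴᵀ = hessMixed Φ := by ext i j; simp
      rw [← h3]
      simpa [Matrix.transpose_mul] using this
    have h3 : Qᴴᵀᴴᵀ = Q := by ext i j; simp
    rw [h3]
    have e1 := congrArg (fun M => M *ᵥ v) h1
    have e2 := congrArg (fun M => M *ᵥ star v) h2'
    simp only [Matrix.add_mulVec, Matrix.smul_mulVec, Matrix.one_mulVec, Matrix.zero_mulVec] at e1 e2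
    have h8 : star (8 : ℂ) = 8 := by simp
    rw [h8, ← smul_add, smul_smul]
    calc v = (16 : ℂ) • ((1 / 16 : ℂ) • v + 0) := by rw [add_zero, smul_smul]; norm_num
      _ = _ := by
        rw [← e1, ← e2]
        norm_num
        abel
  rw [bilin_dualWeight, hinv, dotProduct_smul, dotProduct_add, Matrix.star_dotProduct_star,
    Complex.add_re, smul_eq_mul]
  simp [dotProduct_comm]

/-- Every reduction `(G, C)` of `Φ` yields the reduction `(G†, C†)` of the one weight `Φ†`. -/
theorem isReduction_dual (hΦ : Φ.PosDef) {G C : Matrix (Fin n) (Fin n) ℂ}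
    (h : IsReduction Φ G C) : IsReduction (dualWeight hΦ) (dualG G C) (dualC C) := by
  have hN := h.posDef hΦ
  have hE := dualE_posDef hN
  have hGdet := h.isUnit_det
  have hGHdet : IsUnit (Gᴴ).det := by rw [Matrix.det_conjTranspose]; exact hGdet.star
  have hGTdet : IsUnit (Gᵀ).det := by rwa [Matrix.det_transpose]
  have hGHTdet : IsUnit (Gᴴᵀ).det := by rwa [Matrix.det_transpose]
  have hNdet : IsUnit (1 - Cᴴ * C).det := (Matrix.isUnit_iff_isUnit_det _).1 hN.isUnit
  have hEdet : IsUnit (dualE C).det := (Matrix.isUnit_iff_isUnit_det _).1 hE.isUnit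
  set M := (1 - Cᴴ * C)⁻¹ with hM
  have hCHT : Cᴴᵀ = Cᴴ := by
    ext i j
    simp [h.isSymm.apply i j]
  have hGG : (dualG G C)ᴴ * dualG G C = G⁻¹ * M * (Gᴴ)⁻¹ := by
    rw [dualG, Matrix.conjTranspose_mul, hE.isHermitian.eq, Matrix.conjTranspose_nonsing_inv,
      Matrix.conjTranspose_conjTranspose, hM, ← dualE_mul_self hN]
    noncomm_ring
  have hGCG : (dualG G C)ᵀ * C * dualG G C = (Gᴴᵀ)⁻¹ * C * M * (Gᴴ)⁻¹ := by
    rw [dualG, Matrix.transpose_mul, Matrix.transpose_nonsing_inv, hM, ← dualE_mul_self hN]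
    calc _ = (Gᴴᵀ)⁻¹ * ((dualE C)ᵀ * C) * dualE C * (Gᴴ)⁻¹ := by noncomm_ring
      _ = _ := by rw [dualE_transpose_mul h.isSymm hN]; noncomm_ring
  have key := hess_dualWeight hΦ (P := (1 / 4 : ℂ) • ((dualG G C)ᴴ * dualG G C))
    (Q := (1 / 4 : ℂ) • ((dualG G C)ᵀ * C * dualG G C)) ?_ ?_
  · refine ⟨?_, ?_, key.1, ?_⟩
    · rw [dualG, Matrix.det_mul]
      exact hEdet.mul (by rwa [Matrix.isUnit_nonsing_inv_det_iff])
    · rw [dualC_eq h.isSymm hN]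
      exact h.isSymm.neg
    · rw [key.2, dualC_eq h.isSymm hN, Matrix.mul_neg, Matrix.neg_mul, smul_neg, neg_neg]
  · rw [hGG, hGCG, h.hessMixed_eq, h.hessHol_eq, Matrix.smul_mul, Matrix.mul_smul]
    have e1 : (-((1 / 4 : ℂ) • (Gᵀ * C * G)))ᴴᵀ = -((1 / 4 : ℂ) • (Gᴴ * Cᴴ * Gᴴᵀ)) := by
      rw [Matrix.conjTranspose_neg, Matrix.conjTranspose_smul, Matrix.conjTranspose_mul,
        Matrix.conjTranspose_mul, Matrix.transpose_neg, Matrix.transpose_smul,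
        Matrix.transpose_mul, Matrix.transpose_mul, hCHT]
      have : Gᵀᴴᵀ = Gᴴ := by ext; simp
      rw [this, Matrix.mul_assoc]
      simp
    rw [e1, Matrix.neg_mul, Matrix.smul_mul, Matrix.mul_smul]
    have e2 : Gᴴ * G * (G⁻¹ * M * (Gᴴ)⁻¹) = Gᴴ * M * (Gᴴ)⁻¹ := by
      calc _ = Gᴴ * (G * G⁻¹) * M * (Gᴴ)⁻¹ := by noncomm_ring
        _ = _ := by rw [Matrix.mul_nonsing_inv _ hGdet, Matrix.mul_one]
    have e3 : Gᴴ * Cᴴ * Gᴴᵀ * ((Gᴴᵀ)⁻¹ * C * M * (Gᴴ)⁻¹) = Gᴴ * (Cᴴ * C) * M * (Gᴴ)⁻¹ := by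
      calc _ = Gᴴ * Cᴴ * (Gᴴᵀ * (Gᴴᵀ)⁻¹) * C * M * (Gᴴ)⁻¹ := by noncomm_ring
        _ = _ := by rw [Matrix.mul_nonsing_inv _ hGHTdet]; noncomm_ring
    have e4 : Gᴴ * M * (Gᴴ)⁻¹ - Gᴴ * (Cᴴ * C) * M * (Gᴴ)⁻¹ = 1 := by
      calc _ = Gᴴ * ((1 - Cᴴ * C) * M) * (Gᴴ)⁻¹ := by noncomm_ring
        _ = _ := by rw [hM, Matrix.mul_nonsing_inv _ hNdet, Matrix.mul_one,
                      Matrix.mul_nonsing_inv _ hGHdet]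
    rw [e2, e3, smul_smul, smul_smul, ← sub_eq_add_neg, ← smul_sub, e4]
    norm_num
  · rw [hGG, hGCG, h.hessMixed_eq, h.hessHol_eq, Matrix.neg_mul, Matrix.smul_mul, Matrix.mul_smul]
    have e1 : ((1 / 4 : ℂ) • (Gᴴ * G))ᴴᵀ = (1 / 4 : ℂ) • (Gᵀ * Gᴴᵀ) := by
      rw [Matrix.conjTranspose_smul, Matrix.conjTranspose_mul, Matrix.transpose_smul,
        Matrix.transpose_mul, Matrix.conjTranspose_conjTranspose]
      simp
    have e2 : Gᵀ * C * G * (G⁻¹ * M * (Gᴴ)⁻¹) = Gᵀ * C * M * (Gᴴ)⁻¹ := by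
      calc _ = Gᵀ * C * (G * G⁻¹) * M * (Gᴴ)⁻¹ := by noncomm_ring
        _ = _ := by rw [Matrix.mul_nonsing_inv _ hGdet, Matrix.mul_one]
    have e3 : Gᵀ * Gᴴᵀ * ((Gᴴᵀ)⁻¹ * C * M * (Gᴴ)⁻¹) = Gᵀ * C * M * (Gᴴ)⁻¹ := by
      calc _ = Gᵀ * (Gᴴᵀ * (Gᴴᵀ)⁻¹) * C * M * (Gᴴ)⁻¹ := by noncomm_ring
        _ = _ := by rw [Matrix.mul_nonsing_inv _ hGHTdet, Matrix.mul_one]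
    rw [e1, Matrix.smul_mul, Matrix.mul_smul, e2, e3, neg_add_cancel]

end Dual

/-! ### The determinant of the gradient map -/

section Determinant

variable {n : ℕ}

/-- The real determinant of a complex matrix acting on `ℂⁿ`. -/
theorem det_restrictScalars_toLin' (M : Matrix (Fin n) (Fin n) ℂ) :
    LinearMap.det ((Matrix.toLin' M).restrictScalars ℝ) = ‖M.det‖ ^ 2 := by
  rw [LinearMap.det_restrictScalars, LinearMap.det_toLin', Algebra.norm_complex_apply,
    Complex.normSq_eq_norm_sq]

/-- The antilinear map `w ↦ star (C w)`, as a real-linear map. -/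
noncomputable def conjMul (C : Matrix (Fin n) (Fin n) ℂ) : (Fin n → ℂ) →ₗ[ℝ] (Fin n → ℂ) :=
  LinearMap.pi fun k => Complex.conjAe.toLinearMap ∘ₗ LinearMap.proj k ∘ₗ
    (Matrix.toLin' C).restrictScalars ℝ

theorem conjMul_apply (C : Matrix (Fin n) (Fin n) ℂ) (w : Fin n → ℂ) :
    conjMul C w = star (C *ᵥ w) := by
  ext k
  simp [conjMul]

/-- With `K w = star (C w)`: multiplication by `i` conjugates `1 - K` to `1 + K`, and
`(1 - K)(1 + K) = 1 - Cᴴ C`, so that `det_ℝ (1 - K)² = det_ℝ (1 - Cᴴ C) = det_ℂ (1 - Cᴴ C)²`. -/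
theorem abs_det_one_sub_conjMul {C : Matrix (Fin n) (Fin n) ℂ} (hC : C.IsSymm)
    (hN : (1 - Cᴴ * C).PosDef) :
    |LinearMap.det (LinearMap.id - conjMul C)| = (1 - Cᴴ * C).det.re := by
  have hCHT : Cᴴᵀ = Cᴴ := by
    ext i j
    simp [hC.apply i j]
  let J : (Fin n → ℂ) ≃ₗ[ℝ] (Fin n → ℂ) :=
    (LinearEquiv.smulOfNeZero ℂ (Fin n → ℂ) Complex.I Complex.I_ne_zero).restrictScalars ℝ
  have hJ : ∀ w, J w = Complex.I • w := fun _ => rfl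
  have h1 : (J : (Fin n → ℂ) →ₗ[ℝ] (Fin n → ℂ)) ∘ₗ (LinearMap.id - conjMul C) ∘ₗ
      (J.symm : (Fin n → ℂ) →ₗ[ℝ] (Fin n → ℂ)) = LinearMap.id + conjMul C := by
    refine LinearMap.ext fun w => ?_
    obtain ⟨w, rfl⟩ := J.surjective w
    have hJs : J.symm (Complex.I • w) = w := by rw [← hJ, LinearEquiv.symm_apply_apply]
    simp only [LinearMap.comp_apply, LinearEquiv.coe_coe, LinearMap.sub_apply,
      LinearMap.add_apply, LinearMap.id_apply, conjMul_apply, hJ, hJs, Matrix.mulVec_smul,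
      star_smul, smul_sub]
    rw [sub_eq_add_neg, ← neg_smul]
    simp
  have h2 : (LinearMap.id - conjMul C) ∘ₗ (LinearMap.id + conjMul C) =
      (Matrix.toLin' (1 - Cᴴ * C)).restrictScalars ℝ := by
    refine LinearMap.ext fun w => ?_
    simp only [LinearMap.comp_apply, LinearMap.sub_apply, LinearMap.add_apply, LinearMap.id_apply,
      conjMul_apply, Matrix.mulVec_add, star_add, LinearMap.coe_restrictScalars,
      Matrix.toLin'_apply, Matrix.sub_mulVec, Matrix.one_mulVec]
    rw [star_mulVec_eq C (star _), star_star, hCHT, Matrix.mulVec_mulVec]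
    abel
  have h3 : LinearMap.det (LinearMap.id + conjMul C) = LinearMap.det (LinearMap.id - conjMul C) := by
    rw [← h1, LinearMap.det_conj]
  have h4 := congrArg LinearMap.det h2
  rw [LinearMap.det_comp, h3, det_restrictScalars_toLin', ← sq] at h4
  have h5 := hN.det_pos
  rw [Complex.pos_iff] at h5
  have h6 : ‖(1 - Cᴴ * C).det‖ = (1 - Cᴴ * C).det.re := by
    rw [← Complex.abs_re_eq_norm.2 h5.2.symm, abs_of_pos h5.1]
  rw [← abs_of_pos h5.1, ← sq_eq_sq_iff_abs_eq_abs, h4, h6]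

theorem det_gradMap {Φ : QuadraticForm ℝ (Fin n → ℂ)} (hΦ : Φ.PosDef)
    {G C : Matrix (Fin n) (Fin n) ℂ} (h : IsReduction Φ G C) :
    |LinearMap.det (gradMap Φ)| = ((4 : ℝ) ^ n)⁻¹ * ‖G.det‖ ^ 4 * (1 - Cᴴ * C).det.re := by
  have h1 : gradMap Φ = (1 / 2 : ℝ) • ((Matrix.toLin' Gᴴ).restrictScalars ℝ ∘ₗ
      (LinearMap.id - conjMul C) ∘ₗ (Matrix.toLin' G).restrictScalars ℝ) := by
    refine LinearMap.ext fun x => ?_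
    simp only [gradMap_apply, LinearMap.smul_apply, LinearMap.comp_apply, LinearMap.sub_apply,
      LinearMap.id_apply, conjMul_apply, LinearMap.coe_restrictScalars, Matrix.toLin'_apply,
      h.hessMixed_eq, h.hessHol_eq]
    have e1 : star ((-((1 / 4 : ℂ) • (Gᵀ * C * G))) *ᵥ x) =
        -((1 / 4 : ℂ) • (Gᴴ *ᵥ star (C *ᵥ G *ᵥ x))) := by
      rw [Matrix.neg_mulVec, Matrix.smul_mulVec, ← Matrix.mulVec_mulVec, ← Matrix.mulVec_mulVec,
        star_neg, star_smul, star_mulVec_eq Gᵀ]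
      have : Gᵀᴴᵀ = Gᴴ := by ext; simp
      rw [this]
      simp
    rw [e1, Matrix.mulVec_sub, Matrix.smul_mulVec, ← Matrix.mulVec_mulVec, ← sub_eq_add_neg,
      ← smul_sub, smul_smul]
    ext k
    simp only [Pi.smul_apply, Complex.real_smul, smul_eq_mul]
    push_cast
    ring
  rw [h1, LinearMap.det_smul, LinearMap.det_comp, LinearMap.det_comp, det_restrictScalars_toLin',
    det_restrictScalars_toLin', abs_mul, abs_mul, abs_mul, abs_det_one_sub_conjMul h.isSymm
    (h.posDef hΦ), Matrix.det_conjTranspose, norm_star, abs_of_nonneg (sq_nonneg ‖G.det‖),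
    abs_of_pos (by positivity)]
  have hfin : Module.finrank ℝ (Fin n → ℂ) = 2 * n := by
    rw [finrank_real_of_complex]; simp
  rw [hfin, pow_mul, ← inv_pow]
  norm_num
  ring

end Determinant

/-! ### Hermitian forms -/

section HermitianForm

variable {n : ℕ}

/-- The quadratic form `x ↦ x^* P x` of a complex matrix `P` (its real part, if `P` is not
Hermitian). -/
noncomputable def hermForm (P : Matrix (Fin n) (Fin n) ℂ) : QuadraticForm ℝ (Fin n → ℂ) :=
  LinearMap.BilinMap.toQuadraticMap <| LinearMap.mk₂ ℝ (fun x v => (star x ⬝ᵥ P *ᵥ v).re)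
    (fun _ _ _ => by simp [add_dotProduct]) (fun _ _ _ => by simp [smul_dotProduct])
    (fun _ _ _ => by simp [Matrix.mulVec_add]) (fun _ _ _ => by simp [Matrix.mulVec_smul])

theorem hermForm_apply (P : Matrix (Fin n) (Fin n) ℂ) (x : Fin n → ℂ) :
    hermForm P x = (star x ⬝ᵥ P *ᵥ x).re := rfl

theorem bilin_hermForm {P : Matrix (Fin n) (Fin n) ℂ} (hP : P.IsHermitian) (x v : Fin n → ℂ) :
    bilin (hermForm P) x v = (star x ⬝ᵥ P *ᵥ v).re := by
  have h1 : star v ⬝ᵥ P *ᵥ x = star (star x ⬝ᵥ P *ᵥ v) := by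
    rw [Matrix.star_dotProduct, Matrix.star_mulVec, hP.eq, ← Matrix.dotProduct_mulVec]
  rw [bilin, hermForm, QuadraticMap.associated_toQuadraticMap]
  simp only [LinearMap.mk₂_apply, h1]
  simp
  ring

theorem hermForm_posDef {P : Matrix (Fin n) (Fin n) ℂ} (hP : P.PosDef) : (hermForm P).PosDef := by
  intro x hx
  exact (Complex.pos_iff.1 ((Matrix.posDef_iff_dotProduct_mulVec.1 hP).2 hx)).1

theorem isReduction_hermForm {G : Matrix (Fin n) (Fin n) ℂ} (hG : IsUnit G.det) :
    IsReduction (hermForm ((1 / 4 : ℂ) • (Gᴴ * G))) G 0 := by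
  have hP : ((1 / 4 : ℂ) • (Gᴴ * G)).IsHermitian := by
    rw [Matrix.IsHermitian, Matrix.conjTranspose_smul,
      (Matrix.isHermitian_conjTranspose_mul_self G).eq]
    simp
  have h := hess_unique (hermForm ((1 / 4 : ℂ) • (Gᴴ * G))) (P := (1 / 4 : ℂ) • (Gᴴ * G)) (Q := 0)
    fun x v => by rw [bilin_hermForm hP]; simp
  exact ⟨hG, Matrix.isSymm_zero, h.1, by rw [h.2]; simp⟩

theorem hermForm_one_apply (x : Fin n → ℂ) : hermForm 1 x = ∑ j, ‖x j‖ ^ 2 := by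
  rw [hermForm_apply, Matrix.one_mulVec, dotProduct, Complex.re_sum]
  refine Finset.sum_congr rfl fun j _ => ?_
  rw [Pi.star_apply, Complex.star_def, Complex.conj_mul']
  norm_cast

theorem bilin_hermForm_one (x v : Fin n → ℂ) :
    bilin (hermForm 1) x v = ∑ j, inner ℝ (x j) (v j) := by
  rw [bilin_hermForm Matrix.isHermitian_one, Matrix.one_mulVec, dotProduct, Complex.re_sum]
  refine Finset.sum_congr rfl fun j _ => ?_
  rw [Complex.inner, mul_comm]
  rfl

end HermitianForm

/-! ### Gaussian integrals -/

section Gaussian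

variable {n : ℕ} {Φ : QuadraticForm ℝ (Fin n → ℂ)}

theorem equivalent_sum_sq (hΦ : Φ.PosDef) : QuadraticMap.Equivalent Φ
    (QuadraticMap.weightedSumSquares ℝ
      fun _ : Fin (Module.finrank ℝ (Fin n → ℂ)) => (1 : ℝ)) := by
  have hsep : LinearMap.SeparatingLeft (QuadraticMap.associated (R := ℝ) Φ) := by
    intro x hx
    by_contra hne
    have := hΦ x hne
    rw [← bilin_self, bilin, hx x] at this
    exact lt_irrefl _ this
  obtain ⟨w, hw, ⟨e⟩⟩ := QuadraticForm.equivalent_one_neg_one_weighted_sum_squared Φ hsep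
  have hw1 : w = fun _ => 1 := by
    ext i
    refine (hw i).resolve_left fun hi => ?_
    have hne : e.symm (Pi.single i 1) ≠ 0 := fun h0 => by
      have := congrArg e h0
      rw [QuadraticMap.IsometryEquiv.apply_symm_apply] at this
      have h1 := congrFun (this.trans (map_zero e.toLinearEquiv)) i
      simp at h1
    have hpos := hΦ _ hne
    rw [← e.map_app, QuadraticMap.IsometryEquiv.apply_symm_apply,
      QuadraticMap.weightedSumSquares_apply, Finset.sum_eq_single i
      (fun j _ hj => by simp [hj]) (by simp), hi] at hpos
    norm_num at hpos
  subst hw1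
  exact ⟨e⟩

/-- By Sylvester's law of inertia a positive definite form is, up to a real-linear change of
variables, the square of the standard norm. -/
theorem exists_linearEquiv_hermForm_one (hΦ : Φ.PosDef) :
    ∃ T : (Fin n → ℂ) ≃ₗ[ℝ] (Fin n → ℂ), ∀ x v,
      bilin (hermForm 1) (T x) (T v) = bilin Φ x v := by
  obtain ⟨e⟩ := (equivalent_sum_sq hΦ).trans
    (equivalent_sum_sq (hermForm_posDef (Matrix.PosDef.one (n := Fin n) (R := ℂ)))).symm
  refine ⟨e.toLinearEquiv, fun x v => ?_⟩
  have h1 := weight_add (hermForm 1) (e.toLinearEquiv x) (e.toLinearEquiv v)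
  have h2 := weight_add Φ x v
  have h3 : ∀ x, hermForm 1 (e.toLinearEquiv x) = Φ x := e.map_app
  rw [← map_add, h3, h3, h3] at h1
  linarith

theorem det_gradMap_eq_of_equiv {T : (Fin n → ℂ) ≃ₗ[ℝ] (Fin n → ℂ)}
    (hT : ∀ x v, bilin (hermForm 1) (T x) (T v) = bilin Φ x v) :
    LinearMap.det (gradMap Φ) = 4 ^ n * LinearMap.det (T : (Fin n → ℂ) →ₗ[ℝ] (Fin n → ℂ)) ^ 2 := by
  let b := Module.finBasis ℝ (Fin n → ℂ)
  let B : LinearMap.BilinForm ℝ (Fin n → ℂ) := bilin (hermForm 1)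
  have hB : B.Nondegenerate := by
    have hpd := hermForm_posDef (Matrix.PosDef.one (n := Fin n) (R := ℂ))
    have hs : ∀ x, (∀ y, B x y = 0) → x = 0 := fun x hx => by
      by_contra hne
      have := hpd x hne
      rw [← bilin_self] at this
      exact this.ne' (hx x)
    exact ⟨hs, fun x hx => hs x fun y => by
      rw [← hx y]; exact bilin_comm _ _ _⟩
  have hdet : (LinearMap.BilinForm.toMatrix b B).det ≠ 0 :=
    (LinearMap.BilinForm.nondegenerate_iff_det_ne_zero b).1 hB
  have h1 : B.comp (gradMap Φ) LinearMap.id =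
      (2 : ℝ) • B.comp (T : (Fin n → ℂ) →ₗ[ℝ] (Fin n → ℂ)) (T : (Fin n → ℂ) →ₗ[ℝ] (Fin n → ℂ)) := by
    refine LinearMap.ext₂ fun x v => ?_
    have : B (gradMap Φ x) v = 2 * B (T x) (T v) := by
      rw [hT, ← re_star_gradMap_dotProduct, bilin_hermForm Matrix.isHermitian_one,
        Matrix.one_mulVec]
    exact this
  have h2 := congrArg (fun F => (LinearMap.BilinForm.toMatrix b F).det) h1
  simp only [LinearMap.BilinForm.toMatrix_comp b b, map_smul, LinearMap.toMatrix_id,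
    Matrix.det_mul, Matrix.det_transpose, mul_one, LinearMap.det_toMatrix,
    Matrix.det_smul, Fintype.card_fin] at h2
  have hfin : Module.finrank ℝ (Fin n → ℂ) = 2 * n := by
    rw [finrank_real_of_complex]; simp
  have hpow : (2 : ℝ) ^ Module.finrank ℝ (Fin n → ℂ) = 4 ^ n := by
    rw [hfin, pow_mul]
    norm_num
  rw [hpow] at h2
  refine mul_right_cancel₀ hdet ?_
  rw [h2]
  ring

theorem integral_comp_linearEquiv (T : (Fin n → ℂ) ≃ₗ[ℝ] (Fin n → ℂ)) (f : (Fin n → ℂ) → ℂ) :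
    ∫ x, f (T x) = (|LinearMap.det (T : (Fin n → ℂ) →ₗ[ℝ] (Fin n → ℂ))|⁻¹ : ℝ) * ∫ x, f x := by
  have h := T.toContinuousLinearEquiv.toHomeomorph.measurableEmbedding.integral_map
    (μ := volume) f
  have h2 : (volume : Measure (Fin n → ℂ)).map T.toContinuousLinearEquiv.toHomeomorph =
      ENNReal.ofReal |(LinearMap.det (T : (Fin n → ℂ) →ₗ[ℝ] (Fin n → ℂ)))⁻¹| • volume :=
    Measure.map_linearMap_addHaar_eq_smul_addHaar volume T.isUnit_det'.ne_zero
  rw [h2, integral_smul_measure, ENNReal.toReal_ofReal (abs_nonneg _), abs_inv,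
    Complex.real_smul] at h
  exact h.symm

theorem integral_gaussian_hermForm_one (b : Fin n → ℂ) :
    ∫ x, Complex.exp (-2 * (hermForm 1 x : ℂ) + 4 * Complex.I * bilin (hermForm 1) b x) =
      ((Real.pi / 2) ^ n : ℝ) * Complex.exp (-2 * hermForm 1 b) := by
  have h1 : ∀ x : Fin n → ℂ,
      Complex.exp (-2 * (hermForm 1 x : ℂ) + 4 * Complex.I * bilin (hermForm 1) b x) =
      ∏ j, Complex.exp (-2 * (‖x j‖ : ℂ) ^ 2 + 4 * Complex.I * (inner ℝ (b j) (x j) : ℝ)) := by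
    intro x
    rw [← Complex.exp_sum, hermForm_one_apply, bilin_hermForm_one, Finset.sum_add_distrib,
      ← Finset.mul_sum, ← Finset.mul_sum]
    push_cast
    rfl
  simp_rw [h1]
  rw [integral_fintype_prod_volume_eq_prod (fun j (w : ℂ) =>
    Complex.exp (-2 * (‖w‖ : ℂ) ^ 2 + 4 * Complex.I * (inner ℝ (b j) w : ℝ)))]
  have h2 : ∀ j, ∫ w : ℂ, Complex.exp (-2 * (‖w‖ : ℂ) ^ 2 +
      4 * Complex.I * (inner ℝ (b j) w : ℝ)) =
      (Real.pi / 2 : ℂ) * Complex.exp (-2 * ‖b j‖ ^ 2) := by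
    intro j
    rw [GaussianFourier.integral_cexp_neg_mul_sq_norm_add (by norm_num), Complex.finrank_real_complex]
    congr 2
    · norm_num
    · rw [mul_pow, Complex.I_sq]; ring
  simp_rw [h2]
  rw [Finset.prod_mul_distrib, ← Complex.exp_sum, ← Finset.mul_sum, hermForm_one_apply]
  simp [div_pow]

/-- The Gaussian integral `∫ e^{-2Φ}` and the Fourier transform of the Gaussian `e^{-2Φ}`. -/
theorem integral_gaussian_fourier (hΦ : Φ.PosDef) (b : Fin n → ℂ) :
    ∫ x, Complex.exp (-2 * (Φ x : ℂ) + 4 * Complex.I * bilin Φ b x) =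
      (Real.pi ^ n / √|LinearMap.det (gradMap Φ)| : ℝ) * Complex.exp (-2 * Φ b) := by
  obtain ⟨T, hT⟩ := exists_linearEquiv_hermForm_one hΦ
  have hTq : ∀ x, hermForm 1 (T x) = Φ x := fun x => by rw [← bilin_self, hT, bilin_self]
  have h1 := integral_comp_linearEquiv T fun x =>
    Complex.exp (-2 * (hermForm 1 x : ℂ) + 4 * Complex.I * bilin (hermForm 1) (T b) x)
  simp only [hT, hTq] at h1
  rw [h1, integral_gaussian_hermForm_one, hTq, ← mul_assoc, ← Complex.ofReal_mul,
    det_gradMap_eq_of_equiv hT]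
  congr 2
  have h4 : (4 : ℝ) ^ n = (2 ^ n) ^ 2 := by rw [← pow_mul, mul_comm, pow_mul]; norm_num
  rw [h4, ← mul_pow, abs_sq, Real.sqrt_sq_eq_abs, abs_mul,
    abs_of_pos (by positivity : (0 : ℝ) < 2 ^ n), div_pow]
  field_simp

theorem integral_gaussian (hΦ : Φ.PosDef) (a b : Fin n → ℂ) :
    ∫ x, Complex.exp (-2 * (Φ x : ℂ) + (4 * bilin Φ a x + 4 * Complex.I * bilin Φ b x)) =
      (Real.pi ^ n / √|LinearMap.det (gradMap Φ)| : ℝ) *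
        Complex.exp (2 * Φ a - 2 * Φ b + 4 * Complex.I * bilin Φ a b) := by
  rw [← integral_add_right_eq_self _ a]
  have h1 : ∀ x : Fin n → ℂ, Complex.exp (-2 * (Φ (x + a) : ℂ) +
      (4 * bilin Φ a (x + a) + 4 * Complex.I * bilin Φ b (x + a))) =
      Complex.exp (2 * Φ a + 4 * Complex.I * bilin Φ a b) *
        Complex.exp (-2 * (Φ x : ℂ) + 4 * Complex.I * bilin Φ b x) := by
    intro x
    rw [← Complex.exp_add, weight_add, map_add, map_add, bilin_self, bilin_comm Φ x a,
      bilin_comm Φ b a]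
    congr 1
    push_cast
    ring
  simp_rw [h1]
  rw [integral_const_mul, integral_gaussian_fourier hΦ, mul_left_comm, ← Complex.exp_add]
  congr 2
  ring

variable (Φ) in
/-- The polarisation `Ψ(x, ȳ)` of the weight: holomorphic in `x`, antiholomorphic in `y`, and
equal to `Φ(x)` for `y = x`. -/
noncomputable def polarWeight (x y : Fin n → ℂ) : ℂ :=
  star y ⬝ᵥ hessMixed Φ *ᵥ x +
    (x ⬝ᵥ hessHol Φ *ᵥ x + star (y ⬝ᵥ hessHol Φ *ᵥ y)) / 2

theorem star_dotProduct_hessMixed (x y : Fin n → ℂ) :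
    star y ⬝ᵥ hessMixed Φ *ᵥ x = star (star x ⬝ᵥ hessMixed Φ *ᵥ y) := by
  rw [Matrix.star_dotProduct, Matrix.star_mulVec, (hessMixed_isHermitian Φ).eq,
    ← Matrix.dotProduct_mulVec]

theorem dotProduct_hessHol_comm (x y : Fin n → ℂ) :
    x ⬝ᵥ hessHol Φ *ᵥ y = y ⬝ᵥ hessHol Φ *ᵥ x := by
  rw [Matrix.dotProduct_mulVec, ← Matrix.mulVec_transpose, (hessHol_isSymm Φ).eq, dotProduct_comm]

theorem polarWeight_eq (x y : Fin n → ℂ) :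
    2 * polarWeight Φ x y = 2 * Φ ((1 / 2 : ℂ) • (x + y)) -
      2 * Φ ((Complex.I / 2) • (y - x)) +
      4 * Complex.I * bilin Φ ((1 / 2 : ℂ) • (x + y)) ((Complex.I / 2) • (y - x)) := by
  have hxx := (hessMixed_isHermitian Φ).im_star_dotProduct_mulVec_self x
  have hyy := (hessMixed_isHermitian Φ).im_star_dotProduct_mulVec_self y
  simp only [← bilin_self, bilin_eq, polarWeight]
  simp only [star_smul, star_add, star_sub, Matrix.mulVec_smul, Matrix.mulVec_add,
    Matrix.mulVec_sub, smul_dotProduct, dotProduct_smul, add_dotProduct, sub_dotProduct,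
    dotProduct_add, dotProduct_sub, smul_eq_mul, dotProduct_hessHol_comm y x,
    star_dotProduct_hessMixed x y]
  generalize star x ⬝ᵥ hessMixed Φ *ᵥ x = pxx at *
  generalize star y ⬝ᵥ hessMixed Φ *ᵥ y = pyy at *
  generalize star x ⬝ᵥ hessMixed Φ *ᵥ y = pxy at *
  generalize x ⬝ᵥ hessHol Φ *ᵥ x = qxx at *
  generalize y ⬝ᵥ hessHol Φ *ᵥ y = qyy at *
  generalize x ⬝ᵥ hessHol Φ *ᵥ y = qxy at *
  change pxx.im = 0 at hxx
  change pyy.im = 0 at hyy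
  apply Complex.ext
  · simp [hxx, hyy]
    ring
  · simp [hxx, hyy]
    ring

/-- The Laplace transform of `e^{-2Φ†}` is a multiple of the reproducing kernel `e^{2Ψ}`: the
Gaussian form of the Legendre duality between `Φ` and `Φ†`. -/
theorem integral_dualWeight (hΦ : Φ.PosDef) (x y : Fin n → ℂ) :
    ∫ z, Complex.exp ((star z ⬝ᵥ x + star y ⬝ᵥ z) / 2 - 2 * dualWeight hΦ z) =
      ((4 * Real.pi) ^ n * √|LinearMap.det (gradMap Φ)| : ℝ) *
        Complex.exp (2 * polarWeight Φ x y) := by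
  let T : (Fin n → ℂ) ≃ₗ[ℝ] (Fin n → ℂ) :=
    (gradEquiv hΦ).trans (LinearEquiv.smulOfNeZero ℝ (Fin n → ℂ) 2 two_ne_zero)
  have hT : ∀ t, T t = (2 : ℝ) • gradMap Φ t := fun t => rfl
  have hdetT : LinearMap.det (T : (Fin n → ℂ) →ₗ[ℝ] (Fin n → ℂ)) =
      4 ^ n * LinearMap.det (gradMap Φ) := by
    have : (T : (Fin n → ℂ) →ₗ[ℝ] (Fin n → ℂ)) = (2 : ℝ) • gradMap Φ := rfl
    have hfin : Module.finrank ℝ (Fin n → ℂ) = 2 * n := by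
      rw [finrank_real_of_complex]; simp
    rw [this, LinearMap.det_smul, hfin, pow_mul]
    norm_num
  have h1 := integral_comp_linearEquiv T fun z =>
    Complex.exp ((star z ⬝ᵥ x + star y ⬝ᵥ z) / 2 - 2 * dualWeight hΦ z)
  have h2 : ∀ t, Complex.exp ((star (T t) ⬝ᵥ x + star y ⬝ᵥ T t) / 2 - 2 * dualWeight hΦ (T t)) =
      Complex.exp (-2 * (Φ t : ℂ) + (4 * bilin Φ ((1 / 2 : ℂ) • (x + y)) t +
        4 * Complex.I * bilin Φ ((Complex.I / 2) • (y - x)) t)) := by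
    intro t
    rw [hT, dualWeight_two_smul_gradMap]
    congr 1
    have e1 := re_star_gradMap_dotProduct Φ t ((1 / 2 : ℂ) • (x + y))
    have e2 := re_star_gradMap_dotProduct Φ t ((Complex.I / 2) • (y - x))
    rw [bilin_comm] at e1 e2
    have e3 : star y ⬝ᵥ gradMap Φ t = star (star (gradMap Φ t) ⬝ᵥ y) := Matrix.star_dotProduct _ _
    have e4 : star ((2 : ℝ) • gradMap Φ t) = (2 : ℂ) • star (gradMap Φ t) := by
      ext k
      simp
    have e5 : (2 : ℝ) • gradMap Φ t = (2 : ℂ) • gradMap Φ t := by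
      ext k
      simp
    rw [e4, e5, smul_dotProduct, dotProduct_smul, e3]
    simp only [dotProduct_smul, dotProduct_add, dotProduct_sub, smul_eq_mul] at e1 e2 ⊢
    generalize star (gradMap Φ t) ⬝ᵥ x = gx at *
    generalize star (gradMap Φ t) ⬝ᵥ y = gy at *
    have e6 : (4 * bilin Φ ((1 / 2 : ℂ) • (x + y)) t : ℂ) =
        ((2 * (1 / 2 * (gx + gy)).re : ℝ) : ℂ) := by
      rw [e1]; push_cast; ring
    have e7 : (4 * Complex.I * bilin Φ ((Complex.I / 2) • (y - x)) t : ℂ) =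
        Complex.I * ((2 * (Complex.I / 2 * (gy - gx)).re : ℝ) : ℂ) := by
      rw [e2]; push_cast; ring
    rw [e6, e7]
    apply Complex.ext
    · simp; ring
    · simp; ring
  simp only [h2] at h1
  rw [integral_gaussian hΦ, hdetT, abs_mul, abs_of_pos (by positivity : (0 : ℝ) < 4 ^ n)] at h1
  have hne : |LinearMap.det (gradMap Φ)| ≠ 0 :=
    abs_ne_zero.2 (LinearEquiv.isUnit_det' (gradEquiv hΦ)).ne_zero
  have hpos : 0 < |LinearMap.det (gradMap Φ)| := lt_of_le_of_ne (abs_nonneg _) hne.symm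
  rw [polarWeight_eq]
  have h3 : ((4 ^ n * |LinearMap.det (gradMap Φ)|)⁻¹ : ℝ) ≠ 0 := by positivity
  refine mul_left_cancel₀ (Complex.ofReal_ne_zero.2 h3) ?_
  rw [← h1, ← mul_assoc, ← Complex.ofReal_mul]
  congr 2
  rw [mul_pow]
  have hs := Real.mul_self_sqrt hpos.le
  have hs0 : √|LinearMap.det (gradMap Φ)| ≠ 0 := (Real.sqrt_pos.2 hpos).ne'
  field_simp
  rw [sq, hs]

end Gaussian

/-! ### Integrability against Gaussians -/

section Integrability

variable {n : ℕ} {Φ : QuadraticForm ℝ (Fin n → ℂ)}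

theorem exists_mul_sq_norm_le (hΦ : Φ.PosDef) : ∃ δ : ℝ, 0 < δ ∧ ∀ x, δ * ‖x‖ ^ 2 ≤ Φ x := by
  obtain ⟨T, hT⟩ := exists_linearEquiv_hermForm_one hΦ
  let S : (Fin n → ℂ) →L[ℝ] (Fin n → ℂ) := T.symm.toContinuousLinearEquiv.toContinuousLinearMap
  have hS : ∀ x, S (T x) = x := fun x => T.symm_apply_apply x
  set c := ‖S‖ + 1 with hc
  have hcpos : 0 < c := by positivity
  refine ⟨(c ^ 2)⁻¹, by positivity, fun x => ?_⟩
  have h1 : ‖x‖ ≤ c * ‖T x‖ := by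
    calc ‖x‖ = ‖S (T x)‖ := by rw [hS]
      _ ≤ ‖S‖ * ‖T x‖ := S.le_opNorm _
      _ ≤ c * ‖T x‖ := by gcongr; linarith
  have h2 : ‖T x‖ ^ 2 ≤ Φ x := by
    rw [← bilin_self Φ, ← hT, bilin_self, hermForm_one_apply]
    have hs : 0 ≤ ∑ j, ‖T x j‖ ^ 2 := by positivity
    have h3 : ‖T x‖ ≤ √(∑ j, ‖T x j‖ ^ 2) := by
      refine (pi_norm_le_iff_of_nonneg (Real.sqrt_nonneg _)).2 fun j => ?_
      refine Real.le_sqrt_of_sq_le ?_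
      exact Finset.single_le_sum (f := fun j => ‖T x j‖ ^ 2) (fun _ _ => by positivity)
        (Finset.mem_univ j)
    calc ‖T x‖ ^ 2 ≤ √(∑ j, ‖T x j‖ ^ 2) ^ 2 := by gcongr
      _ = _ := Real.sq_sqrt hs
  rw [inv_mul_le_iff₀ (by positivity)]
  calc ‖x‖ ^ 2 ≤ (c * ‖T x‖) ^ 2 := by gcongr
    _ = c ^ 2 * ‖T x‖ ^ 2 := by ring
    _ ≤ c ^ 2 * Φ x := by gcongr

theorem integrable_exp_neg_weight (hΦ : Φ.PosDef) {ε : ℝ} (hε : 0 < ε) (R : ℝ) :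
    Integrable fun x => Real.exp (-ε * Φ x + R * ‖x‖) := by
  obtain ⟨δ, hδ, hle⟩ := exists_mul_sq_norm_le hΦ
  have hcont := HSpace.continuous_weight Φ
  set m := Module.finrank ℝ (Fin n → ℂ) + 1 with hm
  have hint : Integrable fun x : Fin n → ℂ => (1 + ‖x‖) ^ (-(m : ℝ)) :=
    integrable_one_add_norm (by rw [hm]; push_cast; linarith)
  set a := ε * δ with ha
  have hapos : 0 < a := by positivity
  set K := (m ! : ℝ) * Real.exp (1 + (R + 1) ^ 2 / (4 * a)) with hK
  refine (hint.const_mul K).mono' (by fun_prop) (Filter.Eventually.of_forall fun x => ?_)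
  rw [Real.norm_of_nonneg (Real.exp_pos _).le, Real.rpow_neg (by positivity), Real.rpow_natCast,
    ← div_eq_mul_inv, le_div_iff₀ (by positivity)]
  have h1 : (1 + ‖x‖) ^ m ≤ m ! * Real.exp (1 + ‖x‖) := by
    have := Real.pow_div_factorial_le_exp (1 + ‖x‖) (by positivity) m
    rw [div_le_iff₀ (by positivity)] at this
    linarith
  have h2 : -ε * Φ x + R * ‖x‖ + (1 + ‖x‖) ≤ 1 + (R + 1) ^ 2 / (4 * a) := by
    have h3 : (R + 1) * ‖x‖ - a * ‖x‖ ^ 2 ≤ (R + 1) ^ 2 / (4 * a) := by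
      rw [le_div_iff₀ (by positivity)]
      nlinarith [sq_nonneg (2 * a * ‖x‖ - (R + 1))]
    have h4 : a * ‖x‖ ^ 2 ≤ ε * Φ x := by
      rw [ha, mul_assoc]
      exact mul_le_mul_of_nonneg_left (hle x) hε.le
    linarith
  calc Real.exp (-ε * Φ x + R * ‖x‖) * (1 + ‖x‖) ^ m
      ≤ Real.exp (-ε * Φ x + R * ‖x‖) * (m ! * Real.exp (1 + ‖x‖)) := by gcongr
    _ = m ! * Real.exp (-ε * Φ x + R * ‖x‖ + (1 + ‖x‖)) := by
      rw [Real.exp_add _ (1 + ‖x‖)]; ring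
    _ ≤ K := by rw [hK]; gcongr

end Integrability

/-! ### The mean value property -/

section MeanValue

variable {n : ℕ}

theorem measurePreserving_unit_smul {c : ℂ} (hc : ‖c‖ = 1) :
    MeasurePreserving fun z : Fin n → ℂ => c • z := by
  have h1 : LinearMap.det
      ((Matrix.toLin' (c • (1 : Matrix (Fin n) (Fin n) ℂ))).restrictScalars ℝ) = 1 := by
    rw [det_restrictScalars_toLin', Matrix.det_smul, Matrix.det_one, mul_one, norm_pow, hc]
    simp
  have h2 := Measure.map_linearMap_addHaar_eq_smul_addHaar (volume : Measure (Fin n → ℂ))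
    (by rw [h1]; exact one_ne_zero)
  have h3 : ⇑((Matrix.toLin' (c • (1 : Matrix (Fin n) (Fin n) ℂ))).restrictScalars ℝ) =
      fun z => c • z := by
    ext1 z
    rw [LinearMap.coe_restrictScalars, Matrix.toLin'_apply, Matrix.smul_mulVec, Matrix.one_mulVec]
  rw [h1, h3] at h2
  exact ⟨by fun_prop, by simpa using h2⟩

theorem measurableEmbedding_unit_smul {c : ℂ} (hc : ‖c‖ = 1) :
    MeasurableEmbedding fun z : Fin n → ℂ => c • z :=
  (Homeomorph.smulOfNeZero c (norm_ne_zero_iff.1 (by rw [hc]; norm_num))).measurableEmbedding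

/-- The mean value property of entire functions against a circularly symmetric weight: average
over the rotations `z ↦ e^{iθ} z` and apply Cauchy's formula on each complex line. -/
theorem integral_mul_circular_weight {f w : (Fin n → ℂ) → ℂ} (hf : Differentiable ℂ f)
    (hw : Continuous w) (hinv : ∀ (c : ℂ) (z : Fin n → ℂ), ‖c‖ = 1 → w (c • z) = w z)
    (hint : Integrable fun z => f z * w z) :
    ∫ z, f z * w z = f 0 * ∫ z, w z := by
  have hnorm : ∀ θ : ℝ, ‖circleMap 0 1 θ‖ = 1 := fun θ => by simp [circleMap]
  have hrot : ∀ θ : ℝ, ∫ z, f (circleMap 0 1 θ • z) * w z = ∫ z, f z * w z := by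
    intro θ
    rw [← (measurePreserving_unit_smul (hnorm θ)).integral_comp
      (measurableEmbedding_unit_smul (hnorm θ)) fun z => f z * w z]
    simp only [hinv _ _ (hnorm θ)]
  have hcm : Continuous (circleMap 0 1) := continuous_circleMap 0 1
  have hfc := hf.continuous
  have hpint : Integrable (fun p : ℝ × (Fin n → ℂ) => f (circleMap 0 1 p.1 • p.2) * w p.2)
      ((volume.restrict (Set.Ioc 0 (2 * Real.pi))).prod volume) := by
    have hcont : Continuous fun p : ℝ × (Fin n → ℂ) =>
        f (circleMap 0 1 p.1 • p.2) * w p.2 := by fun_prop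
    rw [integrable_prod_iff hcont.aestronglyMeasurable]
    constructor
    · refine Filter.Eventually.of_forall fun θ => ?_
      have h := ((measurePreserving_unit_smul (hnorm θ)).integrable_comp_emb
        (measurableEmbedding_unit_smul (hnorm θ))).2 hint
      refine h.congr (Filter.Eventually.of_forall fun z => ?_)
      simp only [Function.comp_apply, hinv _ _ (hnorm θ)]
    · have hconst : ∀ θ : ℝ, ∫ z, ‖f (circleMap 0 1 θ • z) * w z‖ = ∫ z, ‖f z * w z‖ := by
        intro θ
        rw [← (measurePreserving_unit_smul (hnorm θ)).integral_comp
          (measurableEmbedding_unit_smul (hnorm θ)) fun z => ‖f z * w z‖]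
        simp only [hinv _ _ (hnorm θ)]
      simp only [hconst]
      exact integrable_const _
  have hswap := integral_integral_swap (f := fun (θ : ℝ) z => f (circleMap 0 1 θ • z) * w z) hpint
  have hline : ∀ z, ∫ θ in Set.Ioc 0 (2 * Real.pi), f (circleMap 0 1 θ • z) =
      2 * Real.pi * f 0 := by
    intro z
    have hd : DiffContOnCl ℂ (fun ζ : ℂ => f (ζ • z)) (Metric.ball 0 |1|) :=
      (hf.comp (differentiable_id.smul_const z)).diffContOnCl
    have h := hd.circleAverage
    rw [Real.circleAverage_def, zero_smul, intervalIntegral.integral_of_le (by positivity)] at h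
    rw [← h, Complex.real_smul]
    push_cast
    field_simp
  simp only [hrot, integral_mul_const, hline] at hswap
  rw [integral_const_mul] at hswap
  simp only [integral_const, MeasurableSet.univ, measureReal_restrict_apply, Set.univ_inter,
    Real.volume_real_Ioc, sub_zero, Complex.real_smul] at hswap
  rw [max_eq_left (by positivity)] at hswap
  have hpi : (2 * Real.pi : ℂ) ≠ 0 := by
    have := Real.pi_ne_zero
    exact mul_ne_zero two_ne_zero (Complex.ofReal_ne_zero.2 this)
  push_cast at hswap
  refine mul_left_cancel₀ hpi ?_
  rw [hswap]
  ring

end MeanValue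

/-! ### The reproducing kernel -/

section Reproducing

variable {n : ℕ} {Φ : QuadraticForm ℝ (Fin n → ℂ)}

/-- The reproducing property of `e^{2Ψ(x, ȳ)}`. After translation by `x` the integrand is an entire
function times `e^{-2 z^* Φ''_{x̄x} z}`. -/
theorem integral_mul_exp_polarWeight {u : (Fin n → ℂ) → ℂ}
    (hu : Differentiable ℂ u) (x : Fin n → ℂ)
    (hint : Integrable fun y => u y * Complex.exp (2 * polarWeight Φ x y - 2 * Φ y)) :
    ∫ y, u y * Complex.exp (2 * polarWeight Φ x y - 2 * Φ y) =
      u x * ∫ z, Complex.exp (-2 * (hermForm (hessMixed Φ) z : ℂ)) := by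
  set P := hessMixed Φ with hP
  set Q := hessHol Φ with hQ
  let F : (Fin n → ℂ) → ℂ := fun z => u (z + x) * Complex.exp
    (-2 * (star x ⬝ᵥ P *ᵥ z) + x ⬝ᵥ Q *ᵥ x - (z + x) ⬝ᵥ Q *ᵥ (z + x))
  have hF : Differentiable ℂ F := by
    refine (hu.comp (differentiable_id.add_const x)).mul (Differentiable.cexp ?_)
    simp only [dotProduct, Matrix.mulVec, Pi.add_apply]
    fun_prop
  have hkey : ∀ z, u (z + x) * Complex.exp (2 * polarWeight Φ x (z + x) - 2 * Φ (z + x)) =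
      F z * Complex.exp (-2 * (hermForm P z : ℂ)) := by
    intro z
    simp only [F]
    rw [mul_assoc, ← Complex.exp_add]
    congr 2
    rw [weight_eq, hermForm_apply, ← hP, ← hQ, polarWeight, ← hP, ← hQ]
    have hxx := (hessMixed_isHermitian Φ).im_star_dotProduct_mulVec_self x
    rw [← hP] at hxx
    have hzx : star z ⬝ᵥ P *ᵥ x = star (star x ⬝ᵥ P *ᵥ z) := star_dotProduct_hessMixed x z
    have hq : z ⬝ᵥ Q *ᵥ x = x ⬝ᵥ Q *ᵥ z := dotProduct_hessHol_comm z x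
    simp only [star_add, Matrix.mulVec_add, add_dotProduct, dotProduct_add, hzx, hq]
    generalize star x ⬝ᵥ P *ᵥ x = pxx at *
    generalize star z ⬝ᵥ P *ᵥ z = pzz at *
    generalize star x ⬝ᵥ P *ᵥ z = pxz at *
    change pxx.im = 0 at hxx
    apply Complex.ext
    · simp [hxx]
      ring
    · simp [hxx]
      ring
  have hF0 : F 0 = u x := by
    simp [F]
  have hint' := hint.comp_add_right x
  simp only [hkey] at hint'
  rw [← integral_add_right_eq_self _ x]
  simp only [hkey]
  rw [integral_mul_circular_weight hF ?_ ?_ hint', hF0]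
  · have := HSpace.continuous_weight (hermForm P)
    fun_prop
  · intro c z hc
    rw [hermForm_apply, hermForm_apply, star_smul, Matrix.mulVec_smul, smul_dotProduct,
      dotProduct_smul, smul_eq_mul, smul_eq_mul, ← mul_assoc, Complex.star_def, Complex.conj_mul',
      hc]
    simp

end Reproducing

/-! ### Laplace transforms -/

section Laplace

variable {n : ℕ}

/-- The linear functional `x ↦ ⟨z, x⟩ / 2 = z^* x / 2`. -/
noncomputable def halfPairing (z : Fin n → ℂ) : (Fin n → ℂ) →L[ℂ] ℂ :=
  ∑ j, (star (z j) / 2) • ContinuousLinearMap.proj j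

theorem halfPairing_apply (z x : Fin n → ℂ) : halfPairing z x = (star z ⬝ᵥ x) / 2 := by
  simp [halfPairing, dotProduct, Finset.sum_div, div_mul_eq_mul_div]

theorem halfPairing_single (z : Fin n → ℂ) (j : Fin n) :
    halfPairing z (Pi.single j 1) = star (z j) / 2 := by
  simp [halfPairing_apply]

theorem continuous_halfPairing : Continuous (halfPairing (n := n)) := by
  unfold halfPairing
  fun_prop

theorem norm_halfPairing_le (z : Fin n → ℂ) : ‖halfPairing z‖ ≤ n * ‖z‖ := by
  refine ContinuousLinearMap.opNorm_le_bound _ (by positivity) fun x => ?_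
  rw [halfPairing_apply, norm_div, dotProduct]
  have h1 : ‖∑ j, star z j * x j‖ ≤ n * ‖z‖ * ‖x‖ := by
    refine (norm_sum_le _ _).trans ?_
    have : ∀ j ∈ Finset.univ, ‖star z j * x j‖ ≤ ‖z‖ * ‖x‖ := fun j _ => by
      rw [norm_mul, Pi.star_apply, norm_star]
      exact mul_le_mul (norm_le_pi_norm z j) (norm_le_pi_norm x j) (norm_nonneg _) (norm_nonneg _)
    refine (Finset.sum_le_sum this).trans ?_
    simp [mul_assoc]
  have h2 : 0 ≤ (n : ℝ) * ‖z‖ * ‖x‖ := by positivity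
  rw [Complex.norm_ofNat]
  linarith [norm_nonneg (∑ j, star z j * x j)]

/-- Functions that stay integrable after multiplication by any exponential `e^{R‖z‖}`. -/
structure ExpIntegrable (g : (Fin n → ℂ) → ℂ) : Prop where
  aestronglyMeasurable : AEStronglyMeasurable g
  integrable : ∀ R : ℝ, Integrable fun z => ‖g z‖ * Real.exp (R * ‖z‖)

/-- Functions of at most exponential growth. -/
def ExpBounded (p : (Fin n → ℂ) → ℂ) : Prop :=
  ∃ K R : ℝ, ∀ z, ‖p z‖ ≤ K * Real.exp (R * ‖z‖)

theorem ExpBounded.mul {p q : (Fin n → ℂ) → ℂ} (hp : ExpBounded p) (hq : ExpBounded q) :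
    ExpBounded fun z => p z * q z := by
  obtain ⟨K, R, h⟩ := hp
  obtain ⟨K', R', h'⟩ := hq
  refine ⟨K * K', R + R', fun z => ?_⟩
  rw [norm_mul, add_mul, Real.exp_add]
  calc ‖p z‖ * ‖q z‖ ≤ (K * Real.exp (R * ‖z‖)) * (K' * Real.exp (R' * ‖z‖)) :=
        mul_le_mul (h z) (h' z) (norm_nonneg _) ((norm_nonneg _).trans (h z))
    _ = _ := by ring

theorem ExpBounded.one : ExpBounded fun _ : Fin n → ℂ => (1 : ℂ) := ⟨1, 0, by simp⟩

theorem ExpBounded.pow {p : (Fin n → ℂ) → ℂ} (hp : ExpBounded p) (k : ℕ) :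
    ExpBounded fun z => p z ^ k := by
  induction k with
  | zero => simpa using ExpBounded.one
  | succ k ih => simpa only [pow_succ] using ih.mul hp

theorem ExpBounded.coord (j : Fin n) : ExpBounded fun z : Fin n → ℂ => z j := by
  refine ⟨1, 1, fun z => (norm_le_pi_norm z j).trans ?_⟩
  rw [one_mul, one_mul]
  linarith [Real.add_one_le_exp ‖z‖]

theorem ExpBounded.of_norm_eq {p q : (Fin n → ℂ) → ℂ} (hp : ExpBounded p)
    (h : ∀ z, ‖q z‖ = ‖p z‖) : ExpBounded q := by
  obtain ⟨K, R, hK⟩ := hp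
  exact ⟨K, R, fun z => (h z).trans_le (hK z)⟩

theorem ExpBounded.monom (α : Fin n → ℕ) : ExpBounded (monom α) := by
  have h : ∀ s : Finset (Fin n), ExpBounded fun z : Fin n → ℂ => ∏ j ∈ s, z j ^ α j := by
    intro s
    induction s using Finset.cons_induction with
    | empty => simpa using ExpBounded.one
    | cons a s ha ih =>
      simp only [Finset.prod_cons]
      exact ((ExpBounded.coord a).pow _).mul ih
  exact h _

theorem norm_halfPairing_apply_le (z x : Fin n → ℂ) :
    ‖halfPairing z x‖ ≤ n * ‖x‖ * ‖z‖ := by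
  refine ((halfPairing z).le_opNorm x).trans ?_
  calc ‖halfPairing z‖ * ‖x‖ ≤ n * ‖z‖ * ‖x‖ := by gcongr; exact norm_halfPairing_le z
    _ = _ := by ring

theorem norm_exp_halfPairing_le (z x : Fin n → ℂ) :
    ‖Complex.exp (halfPairing z x)‖ ≤ Real.exp (n * ‖x‖ * ‖z‖) := by
  rw [Complex.norm_exp]
  exact Real.exp_le_exp.2 (((Complex.abs_re_le_norm _).trans'
    (le_abs_self _)).trans (norm_halfPairing_apply_le z x))

theorem ExpBounded.exp_halfPairing (x : Fin n → ℂ) :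
    ExpBounded fun z => Complex.exp (halfPairing z x) :=
  ⟨1, n * ‖x‖, fun z => by rw [one_mul]; exact norm_exp_halfPairing_le z x⟩

theorem continuous_exp_halfPairing (x : Fin n → ℂ) :
    Continuous fun z => Complex.exp (halfPairing z x) :=
  Complex.continuous_exp.comp (continuous_halfPairing.clm_apply continuous_const)

theorem ExpIntegrable.integrable_self {g : (Fin n → ℂ) → ℂ} (hg : ExpIntegrable g) :
    Integrable g := by
  refine (hg.integrable 0).mono' hg.aestronglyMeasurable (Filter.Eventually.of_forall fun z => ?_)
  simp

theorem ExpIntegrable.mul {g p : (Fin n → ℂ) → ℂ} (hg : ExpIntegrable g) (hp : ExpBounded p)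
    (hc : Continuous p) : ExpIntegrable fun z => p z * g z := by
  obtain ⟨K, R, hK⟩ := hp
  refine ⟨hc.aestronglyMeasurable.mul hg.aestronglyMeasurable, fun S => ?_⟩
  refine ((hg.integrable (R + S)).const_mul K).mono' ?_ (Filter.Eventually.of_forall fun z => ?_)
  · exact ((hc.aestronglyMeasurable.mul hg.aestronglyMeasurable).norm).mul
      (by fun_prop : Continuous fun z : Fin n → ℂ => Real.exp (S * ‖z‖)).aestronglyMeasurable
  · rw [norm_mul, norm_norm, norm_mul, Real.norm_of_nonneg (Real.exp_pos _).le, add_mul,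
      Real.exp_add]
    calc ‖p z‖ * ‖g z‖ * Real.exp (S * ‖z‖)
        ≤ K * Real.exp (R * ‖z‖) * ‖g z‖ * Real.exp (S * ‖z‖) := by gcongr; exact hK z
      _ = _ := by ring

/-- The Laplace transform `x ↦ ∫ g(z) e^{⟨z, x⟩ / 2} dL(z)`. -/
noncomputable def laplace (g : (Fin n → ℂ) → ℂ) (x : Fin n → ℂ) : ℂ :=
  ∫ z, g z * Complex.exp (halfPairing z x)

theorem hasFDerivAt_laplace {g : (Fin n → ℂ) → ℂ} (hg : ExpIntegrable g) (x₀ : Fin n → ℂ) :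
    HasFDerivAt (laplace g)
      (∫ z, (g z * Complex.exp (halfPairing z x₀)) • halfPairing z) x₀ ∧
    Integrable fun z => (g z * Complex.exp (halfPairing z x₀)) • halfPairing z := by
  set S : ℝ := n * (‖x₀‖ + 1) + 1 with hS
  have hmeas : ∀ x, AEStronglyMeasurable (fun z => g z * Complex.exp (halfPairing z x)) volume :=
    fun x => hg.aestronglyMeasurable.mul (continuous_exp_halfPairing x).aestronglyMeasurable
  have hmeas' : AEStronglyMeasurable
      (fun z => (g z * Complex.exp (halfPairing z x₀)) • halfPairing z) volume :=
    (hmeas x₀).smul continuous_halfPairing.aestronglyMeasurable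
  have hbound : ∀ z, ∀ x ∈ Metric.ball x₀ 1,
      ‖(g z * Complex.exp (halfPairing z x)) • halfPairing z‖ ≤
        n * (‖g z‖ * Real.exp (S * ‖z‖)) := by
    intro z x hx
    have hx' : ‖x‖ ≤ ‖x₀‖ + 1 := by
      have := norm_le_norm_add_norm_sub' x x₀
      rw [mem_ball_iff_norm] at hx
      linarith
    have h1 : ‖Complex.exp (halfPairing z x)‖ ≤ Real.exp (n * (‖x₀‖ + 1) * ‖z‖) :=
      (norm_exp_halfPairing_le z x).trans (by gcongr)
    have h2 : ‖halfPairing z‖ ≤ n * Real.exp ‖z‖ := by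
      refine (norm_halfPairing_le z).trans ?_
      gcongr
      linarith [Real.add_one_le_exp ‖z‖]
    rw [norm_smul, norm_mul]
    calc ‖g z‖ * ‖Complex.exp (halfPairing z x)‖ * ‖halfPairing z‖
        ≤ ‖g z‖ * Real.exp (n * (‖x₀‖ + 1) * ‖z‖) * (n * Real.exp ‖z‖) := by gcongr
      _ = _ := by rw [hS, add_mul, one_mul, Real.exp_add]; ring
  have hbi : Integrable fun z => (n : ℝ) * (‖g z‖ * Real.exp (S * ‖z‖)) :=
    (hg.integrable S).const_mul _
  refine ⟨?_, hbi.mono' hmeas' (Filter.Eventually.of_forall fun z =>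
    hbound z x₀ (Metric.mem_ball_self one_pos))⟩
  refine hasFDerivAt_integral_of_dominated_of_fderiv_le (𝕜 := ℂ)
    (F := fun x z => g z * Complex.exp (halfPairing z x))
    (F' := fun x z => (g z * Complex.exp (halfPairing z x)) • halfPairing z)
    (bound := fun z => (n : ℝ) * (‖g z‖ * Real.exp (S * ‖z‖)))
    (Metric.ball_mem_nhds x₀ one_pos) (Filter.Eventually.of_forall hmeas) ?_ hmeas'
    (Filter.Eventually.of_forall hbound) hbi (Filter.Eventually.of_forall fun z x _ => ?_)
  · have := (hg.mul (ExpBounded.exp_halfPairing x₀) (continuous_exp_halfPairing x₀)).integrable_self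
    simpa only [mul_comm] using this
  · have h := ((halfPairing z).hasFDerivAt (x := x)).cexp.const_mul (g z)
    refine h.congr_fderiv ?_
    rw [smul_smul]

theorem differentiable_laplace {g : (Fin n → ℂ) → ℂ} (hg : ExpIntegrable g) :
    Differentiable ℂ (laplace g) :=
  fun x => (hasFDerivAt_laplace hg x).1.differentiableAt

theorem dHol_of_hasFDerivAt {f : (Fin n → ℂ) → ℂ} {f' : (Fin n → ℂ) →L[ℂ] ℂ} {x : Fin n → ℂ}
    (h : HasFDerivAt f f' x) (j : Fin n) : dHol j f x = f' (Pi.single j 1) := by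
  have h1 : (Pi.single j Complex.I : Fin n → ℂ) = Complex.I • Pi.single j 1 := by
    rw [← Pi.single_smul', smul_eq_mul, mul_one]
  rw [dHol, (h.restrictScalars ℝ).fderiv]
  simp only [ContinuousLinearMap.coe_restrictScalars', h1, map_smul, smul_eq_mul]
  linear_combination (-(1 / 2) * f' (Pi.single j 1)) * Complex.I_mul_I

theorem dHol_laplace {g : (Fin n → ℂ) → ℂ} (hg : ExpIntegrable g) (j : Fin n) :
    dHol j (laplace g) = laplace fun z => star (z j) / 2 * g z := by
  ext x
  obtain ⟨h1, h2⟩ := hasFDerivAt_laplace hg x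
  rw [dHol_of_hasFDerivAt h1, ContinuousLinearMap.integral_apply h2, laplace]
  refine integral_congr_ae (Filter.Eventually.of_forall fun z => ?_)
  simp only [smul_apply, halfPairing_single, smul_eq_mul]
  ring

theorem ExpIntegrable.coord_mul {g : (Fin n → ℂ) → ℂ} (hg : ExpIntegrable g) (j : Fin n) :
    ExpIntegrable fun z => star (z j) / 2 * g z := by
  have h : ExpBounded fun z : Fin n → ℂ => star (z j) / 2 := by
    have := ((ExpBounded.coord j).of_norm_eq (q := fun z => star (z j)) fun z => norm_star _).mul
      (q := fun _ => 1 / 2) ⟨1 / 2, 0, by simp⟩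
    simpa only [mul_one_div] using this
  exact hg.mul h (by fun_prop)

theorem iterate_dHol_laplace {g : (Fin n → ℂ) → ℂ} (hg : ExpIntegrable g) (j : Fin n) (k : ℕ) :
    (dHol j)^[k] (laplace g) = laplace (fun z => (star (z j) / 2) ^ k * g z) ∧
    ExpIntegrable fun z => (star (z j) / 2) ^ k * g z := by
  induction k with
  | zero => simpa using hg
  | succ k ih =>
    rw [Function.iterate_succ_apply', ih.1, dHol_laplace ih.2]
    have h : (fun z : Fin n → ℂ => star (z j) / 2 * ((star (z j) / 2) ^ k * g z)) =
        fun z => (star (z j) / 2) ^ (k + 1) * g z := by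
      ext z
      ring
    rw [h, ← h]
    exact ⟨rfl, ih.2.coord_mul j⟩

/-- Differentiating a Laplace transform multiplies the density by powers of `z̄ / 2`. -/
theorem dHolMulti_laplace {g : (Fin n → ℂ) → ℂ} (hg : ExpIntegrable g) (α : Fin n → ℕ) :
    dHolMulti α (laplace g) =
      laplace fun z => (2 ^ (∑ j, α j) : ℂ)⁻¹ * (star (monom α z) * g z) := by
  have h : ∀ l : List (Fin n),
      l.foldr (fun j f => (dHol j)^[α j] f) (laplace g) =
        laplace (fun z => (l.map fun j => (star (z j) / 2) ^ α j).prod * g z) ∧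
      ExpIntegrable fun z => (l.map fun j => (star (z j) / 2) ^ α j).prod * g z := by
    intro l
    induction l with
    | nil => simpa using hg
    | cons a l ih =>
      rw [List.foldr_cons, ih.1]
      simpa only [List.map_cons, List.prod_cons, mul_assoc] using iterate_dHol_laplace ih.2 a (α a)
  rw [dHolMulti, (h _).1]
  congr 1
  ext z
  rw [← Fin.prod_univ_def]
  simp only [div_pow, Finset.prod_div_distrib, monom, star_prod, star_pow, Finset.prod_pow_eq_pow_sum]
  ring

end Laplace

/-! ### The spaces of entire functions -/

section Space

variable {n : ℕ} {Φ : QuadraticForm ℝ (Fin n → ℂ)}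

theorem measurable_weight_density :
    Measurable fun x => ENNReal.ofReal (Real.exp (-2 * Φ x)) := by
  have := (HSpace.continuous_weight Φ).measurable
  fun_prop

theorem memLp_weightMeasure_iff {u : (Fin n → ℂ) → ℂ} (hu : Continuous u) :
    MemLp u 2 (weightMeasure Φ) ↔ Integrable fun x => ‖u x‖ ^ 2 * Real.exp (-2 * Φ x) := by
  rw [memLp_two_iff_integrable_sq_norm hu.aestronglyMeasurable, weightMeasure,
    integrable_withDensity_iff measurable_weight_density (Filter.Eventually.of_forall fun _ =>
      ENNReal.ofReal_lt_top)]
  simp only [ENNReal.toReal_ofReal (Real.exp_pos _).le]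

theorem HSpace.continuous (u : HSpace Φ) : Continuous u := u.2.1.continuous

theorem HSpace.integrable_sq (u : HSpace Φ) :
    Integrable fun x => ‖u x‖ ^ 2 * Real.exp (-2 * Φ x) :=
  (memLp_weightMeasure_iff u.continuous).1 u.2.2

theorem HSpace.inner_toL2 (k u : HSpace Φ) :
    inner ℂ (HSpace.toL2 Φ k) (HSpace.toL2 Φ u) =
      ∫ x, star (k x) * u x * Complex.exp (-2 * Φ x) := by
  have h1 : HSpace.toL2 Φ k =ᵐ[weightMeasure Φ] k := MemLp.coeFn_toLp k.2.2
  have h2 : HSpace.toL2 Φ u =ᵐ[weightMeasure Φ] u := MemLp.coeFn_toLp u.2.2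
  rw [L2.inner_def]
  have h3 : ∫ x, inner ℂ (HSpace.toL2 Φ k x) (HSpace.toL2 Φ u x) ∂weightMeasure Φ =
      ∫ x, star (k x) * u x ∂weightMeasure Φ := by
    refine integral_congr_ae ?_
    filter_upwards [h1, h2] with x hx1 hx2
    rw [hx1, hx2, RCLike.inner_apply, mul_comm]
    rfl
  rw [h3, weightMeasure, integral_withDensity_eq_integral_toReal_smul measurable_weight_density
    (Filter.Eventually.of_forall fun _ => ENNReal.ofReal_lt_top)]
  refine integral_congr_ae (Filter.Eventually.of_forall fun x => ?_)
  simp only [ENNReal.toReal_ofReal (Real.exp_pos _).le, Complex.real_smul]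
  push_cast
  ring

theorem HSpace.norm_eq (u : HSpace Φ) : ‖u‖ = ‖HSpace.toL2 Φ u‖ := rfl

theorem HSpace.norm_sq_eq (u : HSpace Φ) : ((‖u‖ ^ 2 : ℝ) : ℂ) =
    ∫ x, star (u x) * u x * Complex.exp (-2 * Φ x) := by
  rw [← HSpace.inner_toL2, inner_self_eq_norm_sq_to_K, HSpace.norm_eq]
  push_cast
  rfl

theorem expIntegrable_exp_weight (hΦ : Φ.PosDef) :
    ExpIntegrable fun z => Complex.exp (-2 * Φ z) := by
  have := HSpace.continuous_weight Φ
  refine ⟨by fun_prop, fun R => ?_⟩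
  refine (integrable_exp_neg_weight hΦ two_pos R).congr (Filter.Eventually.of_forall fun z => ?_)
  simp only [Complex.norm_exp, ← Real.exp_add]
  congr 2
  simp

theorem continuous_monom (α : Fin n → ℕ) : Continuous (monom α) := by
  unfold monom
  fun_prop

theorem differentiable_monom (α : Fin n → ℕ) : Differentiable ℂ (monom α) := by
  unfold monom
  fun_prop

/-- The monomial `x^α` as an element of `H_Φ`. -/
noncomputable def monomH (hΦ : Φ.PosDef) (α : Fin n → ℕ) : HSpace Φ :=
  (⟨monom α, differentiable_monom α, (memLp_weightMeasure_iff (continuous_monom α)).2 <| by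
    have h := (((expIntegrable_exp_weight hΦ).mul (ExpBounded.monom α)
      (continuous_monom α)).mul (ExpBounded.monom α) (continuous_monom α)).integrable_self.norm
    refine h.congr (Filter.Eventually.of_forall fun x => ?_)
    simp only [norm_mul, Complex.norm_exp]
    rw [← mul_assoc, sq]
    simp⟩ : holL2 Φ)

theorem monomH_apply (hΦ : Φ.PosDef) (α : Fin n → ℕ) (x : Fin n → ℂ) :
    monomH hΦ α x = monom α x := rfl

end Space

/-! ### The normalising constant -/

section Constant

variable {n : ℕ} (Φ : QuadraticForm ℝ (Fin n → ℂ))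

/-- The constant `C_Φ = (2π)^{-n} det(1 - C^* C)^{-1/4}`. The determinant is encoded, without choice
of a reduction, as the ratio of the real determinants of the gradient maps of `Φ` and of its
Hermitian part. -/
noncomputable def weightConst : ℝ :=
  ((2 * Real.pi) ^ n)⁻¹ * (|LinearMap.det (gradMap Φ)| /
    |LinearMap.det (gradMap (hermForm (hessMixed Φ)))|) ^ (-(1 / 4) : ℝ)

variable {Φ}

theorem weightConst_eq (hΦ : Φ.PosDef) {G C : Matrix (Fin n) (Fin n) ℂ}
    (h : IsReduction Φ G C) :
    weightConst Φ = ((2 * Real.pi) ^ n)⁻¹ * (1 - Cᴴ * C).det.re ^ (-(1 / 4) : ℝ) := by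
  have h1 := det_gradMap hΦ h
  have h2 : |LinearMap.det (gradMap (hermForm (hessMixed Φ)))| =
      ((4 : ℝ) ^ n)⁻¹ * ‖G.det‖ ^ 4 := by
    have h3 := det_gradMap (hermForm_posDef (hessMixed_posDef hΦ))
      (h.hessMixed_eq ▸ isReduction_hermForm h.isUnit_det)
    simpa using h3
  have h4 : ((4 : ℝ) ^ n)⁻¹ * ‖G.det‖ ^ 4 ≠ 0 := by
    have := h.isUnit_det.ne_zero
    positivity
  rw [weightConst, h1, h2, mul_div_cancel_left₀ _ h4]

theorem abs_det_gradMap_pos (hΦ : Φ.PosDef) : 0 < |LinearMap.det (gradMap Φ)| :=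
  abs_pos.2 (LinearEquiv.isUnit_det' (gradEquiv hΦ)).ne_zero

theorem weightConst_pos (hΦ : Φ.PosDef) : 0 < weightConst Φ := by
  have h1 := abs_det_gradMap_pos hΦ
  have h2 := abs_det_gradMap_pos (hermForm_posDef (hessMixed_posDef hΦ))
  unfold weightConst
  positivity

/-- `C_Φ²` is the reciprocal of the product of the constant in `integral_dualWeight` and the Gaussian
integral in `integral_mul_exp_polarWeight`. -/
theorem weightConst_sq_mul (hΦ : Φ.PosDef) :
    weightConst Φ ^ 2 * ((4 * Real.pi) ^ n * √|LinearMap.det (gradMap Φ)| *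
      (Real.pi ^ n / √|LinearMap.det (gradMap (hermForm (hessMixed Φ)))|)) = 1 := by
  have h1 := abs_det_gradMap_pos hΦ
  have h2 := abs_det_gradMap_pos (hermForm_posDef (hessMixed_posDef hΦ))
  unfold weightConst
  generalize |LinearMap.det (gradMap Φ)| = a at *
  generalize |LinearMap.det (gradMap (hermForm (hessMixed Φ)))| = b at *
  have h3 : ((a / b) ^ (-(1 / 4) : ℝ)) ^ 2 = √b / √a := by
    rw [← Real.rpow_natCast, ← Real.rpow_mul (by positivity), ← Real.sqrt_div h2.le,
      Real.sqrt_eq_rpow, ← inv_div, Real.inv_rpow (by positivity), ← Real.rpow_neg (by positivity)]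
    norm_num
  rw [mul_pow, h3]
  have ha := Real.sqrt_pos.2 h1
  have hb := Real.sqrt_pos.2 h2
  have h4 : (4 * Real.pi) ^ n * Real.pi ^ n = ((2 * Real.pi) ^ n) ^ 2 := by
    rw [← mul_pow, ← pow_mul, mul_comm n 2, pow_mul]
    congr 1
    ring
  have hpi : (2 * Real.pi) ^ n ≠ 0 := by positivity
  field_simp
  linear_combination h4

end Constant

/-! ### Representation of the derivatives at the origin -/

section Kernel

variable {n : ℕ} {Φ : QuadraticForm ℝ (Fin n → ℂ)}

/-- The integrand of the double integral representing an element of `H_Φ` is absolutely integrable: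
by the Fenchel inequality it is dominated by a product of integrable functions of `y` and `z`. -/
theorem integrable_kernel_prod (hΦ : Φ.PosDef) (u : HSpace Φ) {p : (Fin n → ℂ) → ℂ}
    (hp : ExpBounded p) (hpc : Continuous p) :
    Integrable (fun q : (Fin n → ℂ) × (Fin n → ℂ) =>
      p q.2 * (Complex.exp (-2 * dualWeight hΦ q.2) *
        (u q.1 * Complex.exp (-2 * Φ q.1) * Complex.exp (star (halfPairing q.2 q.1)))))
      (volume.prod volume) := by
  obtain ⟨K, R, hK⟩ := hp
  have hu := u.continuous
  have hc1 := HSpace.continuous_weight Φ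
  have hc2 := HSpace.continuous_weight (dualWeight hΦ)
  have hc3 : Continuous fun q : (Fin n → ℂ) × (Fin n → ℂ) => halfPairing q.2 q.1 :=
    (continuous_halfPairing.comp continuous_snd).clm_apply continuous_fst
  have hy : Integrable fun y => ‖u y‖ * Real.exp (-(4 / 3) * Φ y) := by
    have h1 := integrable_exp_neg_weight hΦ (ε := 2 / 3) (by norm_num) 0
    refine (u.integrable_sq.add h1).mono' (by fun_prop) (Filter.Eventually.of_forall fun y => ?_)
    have e1 : Real.exp (-2 * Φ y) = Real.exp (-Φ y) ^ 2 := by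
      rw [← Real.exp_nat_mul]
      congr 1
      push_cast
      ring
    have e2 : Real.exp (-(2 / 3) * Φ y + 0 * ‖y‖) = Real.exp (-(1 / 3) * Φ y) ^ 2 := by
      rw [← Real.exp_nat_mul]
      congr 1
      push_cast
      ring
    have e3 : Real.exp (-(4 / 3) * Φ y) = Real.exp (-Φ y) * Real.exp (-(1 / 3) * Φ y) := by
      rw [← Real.exp_add]
      congr 1
      ring
    rw [Pi.add_apply, e1, e2, e3, Real.norm_of_nonneg (by positivity)]
    nlinarith [sq_nonneg (‖u y‖ * Real.exp (-Φ y) - Real.exp (-(1 / 3) * Φ y)),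
      sq_nonneg (‖u y‖ * Real.exp (-Φ y)), sq_nonneg (Real.exp (-(1 / 3) * Φ y))]
  have hz := (integrable_exp_neg_weight (dualWeight_posDef hΦ) (ε := 1 / 2) (by norm_num)
    R).const_mul K
  refine (hy.mul_prod hz).mono' (by fun_prop) (Filter.Eventually.of_forall fun q => ?_)
  obtain ⟨y, z⟩ := q
  -- With `s = 2 / 3` the factors `e^{-4Φ/3}` and `e^{-Φ†/2}` remain; the former beats `|u|`.
  have hf := fenchel hΦ (s := 2 / 3) (by norm_num) y z
  have hre : (star (halfPairing z y)).re = (star y ⬝ᵥ z).re / 2 := by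
    rw [halfPairing_apply, Matrix.star_dotProduct]
    simp
  simp only [norm_mul, Complex.norm_exp, hre]
  have hre1 : ((-2 : ℂ) * (dualWeight hΦ z : ℂ)).re = -2 * dualWeight hΦ z := by simp
  have hre2 : ((-2 : ℂ) * (Φ y : ℂ)).re = -2 * Φ y := by simp
  rw [hre1, hre2]
  calc ‖p z‖ * (Real.exp (-2 * dualWeight hΦ z) *
        (‖u y‖ * Real.exp (-2 * Φ y) * Real.exp ((star y ⬝ᵥ z).re / 2)))
      = ‖p z‖ * ‖u y‖ *
        Real.exp (-2 * dualWeight hΦ z + -2 * Φ y + (star y ⬝ᵥ z).re / 2) := by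
        rw [Real.exp_add, Real.exp_add]
        ring
    _ ≤ K * Real.exp (R * ‖z‖) * ‖u y‖ *
        Real.exp (-(1 / 2) * dualWeight hΦ z + -(4 / 3) * Φ y) := by
        have h0 : 0 ≤ K * Real.exp (R * ‖z‖) := (norm_nonneg _).trans (hK z)
        have hexp : Real.exp (-2 * dualWeight hΦ z + -2 * Φ y + (star y ⬝ᵥ z).re / 2) ≤
            Real.exp (-(1 / 2) * dualWeight hΦ z + -(4 / 3) * Φ y) := by
          refine Real.exp_le_exp.2 ?_
          norm_num at hf
          linarith
        exact mul_le_mul (mul_le_mul_of_nonneg_right (hK z) (norm_nonneg _)) hexp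
          (Real.exp_pos _).le (mul_nonneg h0 (norm_nonneg _))
    _ = _ := by
        rw [Real.exp_add, Real.exp_add]
        ring

/-- The density `g(z) = e^{-2Φ†(z)} ∫ u(y) e^{y^* z / 2} e^{-2Φ(y)} dL(y)`, for which `u` is `C_Φ²`
times the Laplace transform of `g`. -/
noncomputable def density (hΦ : Φ.PosDef) (u : HSpace Φ) (z : Fin n → ℂ) : ℂ :=
  Complex.exp (-2 * dualWeight hΦ z) *
    ∫ y, u y * Complex.exp (-2 * Φ y) * Complex.exp (star (halfPairing z y))

theorem integrable_mul_density (hΦ : Φ.PosDef) (u : HSpace Φ) {p : (Fin n → ℂ) → ℂ}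
    (hp : ExpBounded p) (hpc : Continuous p) :
    Integrable fun z => p z * density hΦ u z := by
  have h := (integrable_kernel_prod hΦ u hp hpc).integral_prod_right
  simp only [integral_const_mul] at h
  exact h

theorem expIntegrable_density (hΦ : Φ.PosDef) (u : HSpace Φ) :
    ExpIntegrable (density hΦ u) := by
  refine ⟨?_, fun R => ?_⟩
  · have := (integrable_mul_density hΦ u ExpBounded.one continuous_const).aestronglyMeasurable
    simpa only [one_mul] using this
  · have h := (integrable_mul_density hΦ u (p := fun z => (Real.exp (R * ‖z‖) : ℂ))
      ⟨1, R, fun z => by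
        rw [Complex.norm_real, Real.norm_of_nonneg (Real.exp_pos _).le, one_mul]⟩
      (by fun_prop)).norm
    refine h.congr (Filter.Eventually.of_forall fun z => ?_)
    simp only [norm_mul, Complex.norm_real, Real.norm_of_nonneg (Real.exp_pos _).le]
    ring

/-- Integration against the density is a pairing of `u` with a Laplace transform. -/
theorem integral_mul_density (hΦ : Φ.PosDef) (u : HSpace Φ) {p : (Fin n → ℂ) → ℂ}
    (hp : ExpBounded p) (hpc : Continuous p) :
    ∫ z, p z * density hΦ u z = ∫ y, (∫ z, p z * Complex.exp (-2 * dualWeight hΦ z) *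
      Complex.exp (star (halfPairing z y))) * u y * Complex.exp (-2 * Φ y) := by
  have h := integral_integral_swap (f := fun y z => p z * (Complex.exp (-2 * dualWeight hΦ z) *
    (u y * Complex.exp (-2 * Φ y) * Complex.exp (star (halfPairing z y)))))
    (integrable_kernel_prod hΦ u hp hpc)
  simp only [density]
  simp only [integral_const_mul] at h
  rw [← h]
  refine integral_congr_ae (Filter.Eventually.of_forall fun y => ?_)
  simp only
  rw [← integral_mul_const, ← integral_mul_const]
  refine integral_congr_ae (Filter.Eventually.of_forall fun z => ?_)
  simp only
  ring

/-- Every element of `H_Φ` is the Laplace transform of `C_Φ²` times its density. -/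
theorem laplace_density (hΦ : Φ.PosDef) (u : HSpace Φ) :
    laplace (fun z => (weightConst Φ ^ 2 : ℂ) * density hΦ u z) = u := by
  ext x
  have hker : ∀ y, ∫ z, Complex.exp (halfPairing z x) * Complex.exp (-2 * dualWeight hΦ z) *
      Complex.exp (star (halfPairing z y)) =
      ((4 * Real.pi) ^ n * √|LinearMap.det (gradMap Φ)| : ℝ) *
        Complex.exp (2 * polarWeight Φ x y) := by
    intro y
    rw [← integral_dualWeight hΦ]
    refine integral_congr_ae (Filter.Eventually.of_forall fun z => ?_)
    simp only
    rw [← Complex.exp_add, ← Complex.exp_add]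
    congr 1
    rw [halfPairing_apply, halfPairing_apply, Matrix.star_dotProduct y]
    simp
    ring
  have h1 := integral_mul_density hΦ u (ExpBounded.exp_halfPairing x) (continuous_exp_halfPairing x)
  have hc1ne : (((4 * Real.pi) ^ n * √|LinearMap.det (gradMap Φ)| : ℝ) : ℂ) ≠ 0 := by
    have := Real.sqrt_pos.2 (abs_det_gradMap_pos hΦ)
    exact Complex.ofReal_ne_zero.2 (by positivity)
  -- Integrating out `z` in the absolutely convergent double integral leaves the kernel `e^{2Ψ}`.
  have hint : Integrable fun y => u y * Complex.exp (2 * polarWeight Φ x y - 2 * Φ y) := by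
    have h2 := (integrable_kernel_prod hΦ u (ExpBounded.exp_halfPairing x)
      (continuous_exp_halfPairing x)).integral_prod_left
    have h3 := h2.const_mul (((4 * Real.pi) ^ n * √|LinearMap.det (gradMap Φ)| : ℝ) : ℂ)⁻¹
    refine h3.congr (Filter.Eventually.of_forall fun y => ?_)
    have h4 : ∀ z, Complex.exp (halfPairing z x) * (Complex.exp (-2 * dualWeight hΦ z) *
        (u y * Complex.exp (-2 * Φ y) * Complex.exp (star (halfPairing z y)))) =
        u y * Complex.exp (-2 * Φ y) * (Complex.exp (halfPairing z x) *
          Complex.exp (-2 * dualWeight hΦ z) * Complex.exp (star (halfPairing z y))) :=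
      fun z => by ring
    simp only [h4]
    rw [integral_const_mul, hker, mul_left_comm,
      inv_mul_cancel_left₀ hc1ne, sub_eq_add_neg, Complex.exp_add, neg_mul]
    ring
  have h2 : ∫ y, (∫ z, Complex.exp (halfPairing z x) * Complex.exp (-2 * dualWeight hΦ z) *
      Complex.exp (star (halfPairing z y))) * u y * Complex.exp (-2 * Φ y) =
      ((4 * Real.pi) ^ n * √|LinearMap.det (gradMap Φ)| : ℝ) *
        ∫ y, u y * Complex.exp (2 * polarWeight Φ x y - 2 * Φ y) := by
    rw [← integral_const_mul]
    refine integral_congr_ae (Filter.Eventually.of_forall fun y => ?_)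
    simp only
    rw [hker, sub_eq_add_neg, Complex.exp_add, neg_mul]
    ring
  have h3 : ∫ z, Complex.exp (-2 * (hermForm (hessMixed Φ) z : ℂ)) =
      ((Real.pi ^ n / √|LinearMap.det (gradMap (hermForm (hessMixed Φ)))| : ℝ) : ℂ) := by
    have := integral_gaussian_fourier (hermForm_posDef (hessMixed_posDef hΦ)) 0
    simpa using this
  rw [h2, integral_mul_exp_polarWeight u.2.1 x hint, h3] at h1
  have h4 := weightConst_sq_mul hΦ
  rw [laplace]
  have h5 : ∀ z, (weightConst Φ ^ 2 : ℂ) * density hΦ u z * Complex.exp (halfPairing z x) =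
      (weightConst Φ ^ 2 : ℂ) * (Complex.exp (halfPairing z x) * density hΦ u z) := fun z => by ring
  simp only [h5]
  rw [integral_const_mul, h1]
  have h6 := congrArg (fun r : ℝ => (r : ℂ)) h4
  simp only [Complex.ofReal_mul, Complex.ofReal_one, Complex.ofReal_pow] at h6
  simp only [Complex.ofReal_mul, Complex.ofReal_pow]
  linear_combination (u x) * h6

/-- The function `C_Φ² 2^{-|α|} ∫ z^α e^{-2Φ†(z)} e^{z^* x / 2} dL(z)`, which represents the functional
`u ↦ ∂^α u(0)` on `H_Φ`. -/
noncomputable def derivKernelFun (hΦ : Φ.PosDef) (α : Fin n → ℕ) : (Fin n → ℂ) → ℂ :=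
  laplace fun z => (weightConst Φ ^ 2 / 2 ^ (∑ j, α j) : ℂ) *
    (monom α z * Complex.exp (-2 * dualWeight hΦ z))

theorem expIntegrable_derivKernel (hΦ : Φ.PosDef) (α : Fin n → ℕ) :
    ExpIntegrable fun z => (weightConst Φ ^ 2 / 2 ^ (∑ j, α j) : ℂ) *
      (monom α z * Complex.exp (-2 * dualWeight hΦ z)) :=
  ((expIntegrable_exp_weight (dualWeight_posDef hΦ)).mul (ExpBounded.monom α)
    (continuous_monom α)).mul ⟨‖(weightConst Φ ^ 2 / 2 ^ (∑ j, α j) : ℂ)‖, 0, by simp⟩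
    continuous_const

/-- The Laplace transform of `z^α e^{-2Φ†}` is `O(e^{2Φ/3})`, hence square integrable against
`e^{-2Φ}`. -/
theorem exists_norm_derivKernelFun_le (hΦ : Φ.PosDef) (α : Fin n → ℕ) :
    ∃ K : ℝ, ∀ y, ‖derivKernelFun hΦ α y‖ ≤ K * Real.exp (2 / 3 * Φ y) := by
  set c : ℂ := (weightConst Φ ^ 2 / 2 ^ (∑ j, α j) : ℂ) with hc
  obtain ⟨K, R, hK⟩ := ExpBounded.monom α
  have hint := (integrable_exp_neg_weight (dualWeight_posDef hΦ) (ε := 1 / 2) (by norm_num)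
    R).const_mul (‖c‖ * K)
  refine ⟨∫ z, ‖c‖ * K * Real.exp (-(1 / 2) * dualWeight hΦ z + R * ‖z‖), fun y => ?_⟩
  rw [derivKernelFun, laplace, ← integral_mul_const]
  refine norm_integral_le_of_norm_le (hint.mul_const _) (Filter.Eventually.of_forall fun z => ?_)
  have hf := fenchel hΦ (s := 2 / 3) (by norm_num) y z
  have hre : (halfPairing z y).re = (star y ⬝ᵥ z).re / 2 := by
    rw [halfPairing_apply, Matrix.star_dotProduct]
    simp
  have hre1 : ((-2 : ℂ) * (dualWeight hΦ z : ℂ)).re = -2 * dualWeight hΦ z := by simp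
  simp only [norm_mul, Complex.norm_exp, hre, hre1]
  calc ‖c‖ * (‖monom α z‖ * Real.exp (-2 * dualWeight hΦ z)) * Real.exp ((star y ⬝ᵥ z).re / 2)
      = ‖c‖ * ‖monom α z‖ * Real.exp (-2 * dualWeight hΦ z + (star y ⬝ᵥ z).re / 2) := by
        rw [Real.exp_add]
        ring
    _ ≤ ‖c‖ * (K * Real.exp (R * ‖z‖)) *
        Real.exp (-(1 / 2) * dualWeight hΦ z + 2 / 3 * Φ y) := by
        have h0 : 0 ≤ K * Real.exp (R * ‖z‖) := (norm_nonneg _).trans (hK z)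
        have hexp : Real.exp (-2 * dualWeight hΦ z + (star y ⬝ᵥ z).re / 2) ≤
            Real.exp (-(1 / 2) * dualWeight hΦ z + 2 / 3 * Φ y) := by
          refine Real.exp_le_exp.2 ?_
          norm_num at hf
          linarith
        exact mul_le_mul (mul_le_mul_of_nonneg_left (hK z) (norm_nonneg _)) hexp
          (Real.exp_pos _).le (mul_nonneg (norm_nonneg _) h0)
    _ = _ := by
        rw [Real.exp_add, Real.exp_add]
        ring

/-- The element of `H_Φ` representing the functional `u ↦ ∂^α u(0)`. -/
noncomputable def derivKernel (hΦ : Φ.PosDef) (α : Fin n → ℕ) : HSpace Φ :=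
  (⟨derivKernelFun hΦ α, differentiable_laplace (expIntegrable_derivKernel hΦ α), by
    have hd : Continuous (derivKernelFun hΦ α) :=
      (differentiable_laplace (expIntegrable_derivKernel hΦ α)).continuous
    have hc := HSpace.continuous_weight Φ
    obtain ⟨K, hK⟩ := exists_norm_derivKernelFun_le hΦ α
    refine (memLp_weightMeasure_iff hd).2 ?_
    refine ((integrable_exp_neg_weight hΦ (ε := 2 / 3) (by norm_num) 0).const_mul (K ^ 2)).mono'
      (by fun_prop) (Filter.Eventually.of_forall fun y => ?_)
    rw [Real.norm_of_nonneg (by positivity)]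
    calc ‖derivKernelFun hΦ α y‖ ^ 2 * Real.exp (-2 * Φ y)
        ≤ (K * Real.exp (2 / 3 * Φ y)) ^ 2 * Real.exp (-2 * Φ y) := by
          gcongr
          exact hK y
      _ = K ^ 2 * Real.exp (-(2 / 3) * Φ y + 0 * ‖y‖) := by
          rw [mul_pow, ← Real.exp_nat_mul, mul_assoc, ← Real.exp_add]
          congr 2
          push_cast
          ring⟩ : holL2 Φ)

theorem derivKernel_apply (hΦ : Φ.PosDef) (α : Fin n → ℕ) (y : Fin n → ℂ) :
    derivKernel hΦ α y = derivKernelFun hΦ α y := rfl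

theorem dHolMulti_eq_inner (hΦ : Φ.PosDef) (α : Fin n → ℕ) (u : HSpace Φ) :
    dHolMulti α u 0 = inner ℂ (HSpace.toL2 Φ (derivKernel hΦ α)) (HSpace.toL2 Φ u) := by
  have hadm : ExpIntegrable fun z => (weightConst Φ ^ 2 : ℂ) * density hΦ u z :=
    (expIntegrable_density hΦ u).mul ⟨‖(weightConst Φ ^ 2 : ℂ)‖, 0, by simp⟩ continuous_const
  have h1 : dHolMulti α u 0 =
      ∫ z, (weightConst Φ ^ 2 / 2 ^ (∑ j, α j) : ℂ) * star (monom α z) * density hΦ u z := by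
    rw [← congrFun (congrArg (dHolMulti α) (laplace_density hΦ u)) 0, dHolMulti_laplace hadm,
      laplace]
    refine integral_congr_ae (Filter.Eventually.of_forall fun z => ?_)
    simp only [map_zero, Complex.exp_zero, mul_one]
    ring
  have hb : ExpBounded fun z : Fin n → ℂ =>
      (weightConst Φ ^ 2 / 2 ^ (∑ j, α j) : ℂ) * star (monom α z) :=
    ExpBounded.mul ⟨‖(weightConst Φ ^ 2 / 2 ^ (∑ j, α j) : ℂ)‖, 0, by simp⟩
      ((ExpBounded.monom α).of_norm_eq fun z => norm_star _)
  have hcm := continuous_monom α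
  rw [h1, integral_mul_density hΦ u hb (by fun_prop), HSpace.inner_toL2]
  refine integral_congr_ae (Filter.Eventually.of_forall fun y => ?_)
  simp only
  congr 2
  rw [derivKernel_apply, derivKernelFun, laplace, Complex.star_def, ← integral_conj]
  refine integral_congr_ae (Filter.Eventually.of_forall fun z => ?_)
  simp only [map_mul, ← Complex.exp_conj, map_div₀, map_pow, Complex.conj_ofReal, map_neg,
    Complex.conj_ofNat]
  ring

theorem norm_derivKernel (hΦ : Φ.PosDef) (α : Fin n → ℕ) :
    ‖derivKernel hΦ α‖ =
      weightConst Φ / 2 ^ (∑ j, α j) * ‖monomH (dualWeight_posDef hΦ) α‖ := by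
  have hC := weightConst_pos hΦ
  have h1 : ((‖derivKernel hΦ α‖ ^ 2 : ℝ) : ℂ) =
      (((weightConst Φ / 2 ^ (∑ j, α j)) ^ 2 * ‖monomH (dualWeight_posDef hΦ) α‖ ^ 2 : ℝ) : ℂ) := by
    have h2 := dHolMulti_eq_inner hΦ α (derivKernel hΦ α)
    rw [inner_self_eq_norm_sq_to_K, ← HSpace.norm_eq] at h2
    have h3 : dHolMulti α (derivKernel hΦ α) 0 = dHolMulti α (derivKernelFun hΦ α) 0 := rfl
    rw [h3, derivKernelFun, dHolMulti_laplace (expIntegrable_derivKernel hΦ α), laplace] at h2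
    rw [Complex.ofReal_mul, HSpace.norm_sq_eq (monomH (dualWeight_posDef hΦ) α),
      ← integral_const_mul, Complex.ofReal_pow]
    refine h2.symm.trans (integral_congr_ae (Filter.Eventually.of_forall fun z => ?_))
    simp only [map_zero, Complex.exp_zero, mul_one, monomH_apply]
    push_cast
    ring
  have h2 := Complex.ofReal_injective h1
  rw [← mul_pow] at h2
  exact (sq_eq_sq₀ (norm_nonneg _) (by positivity)).1 h2

variable (Φ) in
/-- The inclusion of `H_Φ` in `L²`, as a linear isometry. -/
noncomputable def toL2Isometry : HSpace Φ →ₗᵢ[ℂ] Lp ℂ 2 (weightMeasure Φ) :=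
  ⟨HSpace.toL2 Φ, fun _ => rfl⟩

/-- The functional `u ↦ ∂^α u(0)` on `H_Φ`. -/
noncomputable def derivAtZero (hΦ : Φ.PosDef) (α : Fin n → ℕ) : HSpace Φ →L[ℂ] ℂ :=
  (innerSL ℂ (HSpace.toL2 Φ (derivKernel hΦ α))).comp (toL2Isometry Φ).toContinuousLinearMap

theorem derivAtZero_apply (hΦ : Φ.PosDef) (α : Fin n → ℕ) (u : HSpace Φ) :
    derivAtZero hΦ α u = dHolMulti α u 0 :=
  (dHolMulti_eq_inner hΦ α u).symm

theorem norm_derivAtZero (hΦ : Φ.PosDef) (α : Fin n → ℕ) :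
    ‖derivAtZero hΦ α‖ = ‖derivKernel hΦ α‖ := by
  have happ : ∀ u, derivAtZero hΦ α u =
      inner ℂ (HSpace.toL2 Φ (derivKernel hΦ α)) (HSpace.toL2 Φ u) := fun _ => rfl
  refine le_antisymm (ContinuousLinearMap.opNorm_le_bound _ (norm_nonneg _) fun u => ?_) ?_
  · rw [happ]
    exact norm_inner_le_norm _ _
  · rcases (norm_nonneg (derivKernel hΦ α)).eq_or_lt with h0 | h0
    · rw [← h0]
      exact norm_nonneg _
    · have h := (derivAtZero hΦ α).le_opNorm (derivKernel hΦ α)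
      rw [happ, inner_self_eq_norm_sq_to_K, ← HSpace.norm_eq, norm_pow, RCLike.norm_ofReal,
        abs_norm, sq] at h
      exact le_of_mul_le_mul_right h h0

end Kernel

end QuadWeight

theorem theorem1p3 (n : ℕ) (Φ : QuadraticForm ℝ (Fin n → ℂ))
    (hΦ : StrictConvexOn ℝ Set.univ (fun x => Φ x)) :
    QuadWeight.IsReduction Φ (QuadWeight.stdG Φ) (QuadWeight.stdC Φ) ∧
    ∃ (Φd : QuadraticForm ℝ (Fin n → ℂ)) (CΦ : ℝ),
      StrictConvexOn ℝ Set.univ (fun x => Φd x) ∧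
      (∀ G C : Matrix (Fin n) (Fin n) ℂ, QuadWeight.IsReduction Φ G C →
        (1 - Cᴴ * C).PosDef ∧
        QuadWeight.IsReduction Φd (QuadWeight.dualG G C) (QuadWeight.dualC C) ∧
        CΦ = ((2 * Real.pi) ^ n)⁻¹ * (1 - Cᴴ * C).det.re ^ (-(1 / 4) : ℝ)) ∧
      ∀ α : Fin n → ℕ,
        ∃ (P : QuadWeight.HSpace Φ →L[ℂ] QuadWeight.HSpace Φ)
          (m : QuadWeight.HSpace Φ) (md : QuadWeight.HSpace Φd),
          (∀ x, m x = QuadWeight.monom α x) ∧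
          (∀ x, md x = QuadWeight.monom α x) ∧
          (∀ u x, (P u) x = (QuadWeight.multiFactorial α : ℂ)⁻¹ *
            QuadWeight.dHolMulti α u 0 * QuadWeight.monom α x) ∧
          ‖P‖ = CΦ / ((QuadWeight.multiFactorial α : ℝ) * 2 ^ (∑ j, α j)) * ‖m‖ * ‖md‖ := by
  have hpos := QuadWeight.posDef_of_strictConvexOn hΦ
  refine ⟨QuadWeight.isReduction_std hpos, QuadWeight.dualWeight hpos, QuadWeight.weightConst Φ,
    QuadWeight.strictConvexOn_of_posDef (QuadWeight.dualWeight_posDef hpos),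
    fun G C h => ⟨h.posDef hpos, QuadWeight.isReduction_dual hpos h,
      QuadWeight.weightConst_eq hpos h⟩, fun α => ?_⟩
  refine ⟨(QuadWeight.derivAtZero hpos α).smulRight
      ((QuadWeight.multiFactorial α : ℂ)⁻¹ • QuadWeight.monomH hpos α),
    QuadWeight.monomH hpos α, QuadWeight.monomH (QuadWeight.dualWeight_posDef hpos) α,
    fun _ => rfl, fun _ => rfl, fun u x => ?_, ?_⟩
  · have h : ((QuadWeight.derivAtZero hpos α).smulRight
        ((QuadWeight.multiFactorial α : ℂ)⁻¹ • QuadWeight.monomH hpos α) u) x =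
        QuadWeight.derivAtZero hpos α u *
          ((QuadWeight.multiFactorial α : ℂ)⁻¹ * QuadWeight.monom α x) := rfl
    rw [h, QuadWeight.derivAtZero_apply]
    ring
  · rw [ContinuousLinearMap.norm_smulRight_apply, QuadWeight.norm_derivAtZero,
      QuadWeight.norm_derivKernel, norm_smul, norm_inv, Complex.norm_natCast]
    rw [div_mul_eq_div_div_swap]
    ring
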